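/- Let $q\in(0,1)$, let $m,n\ge 1$ be integers and $N=m+n$. Let $\mathbb{C}[SL_N]_q$ be the unital algebra over $\mathbb{C}$ with generators $t_{ij}$, $1\le i,j\le N$, and relations $$t_{\alpha a}t_{\beta b}=q\,t_{\beta b}t_{\alpha a}\quad(a=b,\ \alpha<\beta\ \text{ or }\ a<b,\ \alpha=\beta),\qquad t_{\alpha a}t_{\beta b}=t_{\beta b}t_{\alpha a}\quad(\alpha<\beta,\ a>b),$$ $$t_{\alpha a}t_{\beta b}-t_{\beta b}t_{\alpha a}=(q-q^{-1})\,t_{\beta a}t_{\alpha b}\quad(\alpha<\beta,\ a<b),\qquad {\det}_q\mathbf{t}=1,$$ where ${\det}_q\mathbf{t}=\sum_{s\in S_N}(-q)^{l(s)}t_{1s(1)}\cdots t_{Ns(N)}$ and $l(s)$ is the number of inversions of $s$; $q$-minors are defined by the same formula. Representations of $\mathbb{C}[SL_N]_q$ are tensored by means of the comultiplication $\Delta(t_{ij})=\sum_k t_{ik}\otimes t_{kj}$. Let $\mathbb{C}[\widetilde G]_q$ be the $*$-algebra $\mathbb{C}[SL_N]_q$ with the involution $$t_{ij}^*=\operatorname{sign}\bigl((i-m-\tfrac12)(n-j+\tfrac12)\bigr)(-q)^{j-i}\,{\det}_q\mathbf{t}_{ij},$$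 where $\mathbf{t}_{ij}$ is $\mathbf{t}$ without its $i$-th row and $j$-th column. Let $t$ be the $q$-minor of $\mathbf{t}$ with rows $1,\dots,m$ and columns $n+1,\dots,N$ (in increasing order), and $x=tt^*$. Let $\mathscr{L}_+$ be the pre-Hilbert space with orthogonal basis $\{e_j\}_{j\ge 0}$, $(e_j,e_j)=\prod_{i=1}^{j}(q^{-2i}-1)$, and let $\pi_+$ be the representation of $\mathbb{C}[SL_2]_q$ in $\mathscr{L}_+$ with $$\pi_+(t_{12})e_j=q^{-j}e_j,\quad \pi_+(t_{21})e_j=-q^{-(j+1)}e_j,\quad \pi_+(t_{11})e_j=e_{j+1},\quad \pi_+(t_{22})e_j=(1-q^{-2j})e_{j-1}\ (j>0),\quad \pi_+(t_{22})e_0=0.$$ For $1\le k<N$ let $\psi_{(k,k+1)}:\mathbb{C}[SL_N]_q\to\mathbb{C}[SL_2]_q$ be the homomorphism with $t_{ij}\mapsto t_{i-k+1,\,j-k+1}$ if $i,j\in\{k,k+1\}$ and $t_{ij}\mapsto\delta_{ij}$ otherwise. Let $u\in S_N$ be the permutation with $u(j)=m+j$ for $j\le n$ and $u(j)=j-n$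 for $j>n$, and let $\sigma_1\sigma_2\cdots\sigma_{mn}$ be the word $s_ms_{m-1}\cdots s_1$, where $s_i$ stands for $(i,i+1)(i+1,i+2)\cdots(i+n-1,i+n)$. Put $$\widetilde{\mathcal T}=(\pi_+\circ\psi_{\sigma_1})\otimes\cdots\otimes(\pi_+\circ\psi_{\sigma_{mn}}),\qquad \mathscr{L}=\mathscr{L}_+^{\otimes mn}.$$ Then $u=\sigma_1\cdots\sigma_{mn}$ and $l(u)=mn$, so that this is a reduced expression of $u$. Moreover: (i) $\widetilde{\mathcal T}$ is a $*$-representation of $\mathbb{C}[\widetilde G]_q$ in the pre-Hilbert space $\mathscr{L}$, i.e. $(\widetilde{\mathcal T}(f)v,w)=(v,\widetilde{\mathcal T}(f^*)w)$ for all $f\in\mathbb{C}[\widetilde G]_q$ and $v,w\in\mathscr{L}$. (ii) For all $\Bbbk=(k_1,\dots,k_{mn})\in\mathbb{Z}_+^{mn}$ and $\mathbf{e}_\Bbbk=e_{k_1}\otimes\cdots\otimes e_{k_{mn}}$ one has $\widetilde{\mathcal T}(x)\mathbf{e}_\Bbbk=q^{-2\sum_j k_j}\mathbf{e}_\Bbbk$.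 In particular, the linear operator $\widetilde{\mathcal T}(x)$ on $\mathscr{L}$ is invertible. -/

import Mathlib

open scoped TensorProduct

set_option linter.unusedSectionVars false

namespace QGroup

/-! ### Quantum matrices, quantum determinants and minors

Rows and columns are indexed by `Fin N`, i.e. counted from `0`. The lemmas of this part (Laplace
expansions, multiplicativity of the determinant) serve to show that the comultiplication, the
involution and the homomorphisms `psi` defined below respect the defining relations.

Overview of the definitions: `CSL q N` is the algebra `ℂ[SL_N]_q` given by generators and relations
(`SLRel`), with the comultiplication `CSL.comul` and the homomorphisms `CSL.psi` to `ℂ[SL_2]_q`;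
`CG q m n` is `ℂ[SL_{m+n}]_q` with its involution (whose values on the generators are given by
`CG.star_t` and `CG.starGen`); `Lplus q` is the pre-Hilbert space `𝓛_+` with the representation
`Lplus.piPlus`; `tensorRep` is the tensor product of representations, `LplusPow q r` the
pre-Hilbert space `𝓛_+^{⊗ r}`, and `repT q m n` the representation of `CG q m n`. -/

/-- `l(s)`: the number of inversions of a permutation. -/
def invLength {k : ℕ} (s : Equiv.Perm (Fin k)) : ℕ :=
  (Finset.univ.filter fun p : Fin k × Fin k => p.1 < p.2 ∧ s p.2 < s p.1).card

/-- The `q`-minor of a matrix `M` with rows `r 0, …, r (k-1)` and columns `c 0, …, c (k-1)`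
(taken in this order). -/
noncomputable def qMinor {R : Type*} [Ring R] [Algebra ℂ R] (q : ℂ) {N k : ℕ}
    (M : Fin N → Fin N → R) (r c : Fin k → Fin N) : R :=
  ∑ s : Equiv.Perm (Fin k),
    ((-q) ^ invLength s) • (List.ofFn fun p : Fin k => M (r p) (c (s p))).prod

/-- The `q`-determinant. -/
noncomputable def qDet {R : Type*} [Ring R] [Algebra ℂ R] (q : ℂ) {N : ℕ}
    (M : Fin N → Fin N → R) : R :=
  qMinor q M id id

/-- The quadratic relations between the entries of a quantum matrix. -/
structure IsQMatrix {R : Type*} [Ring R] [Algebra ℂ R] (q : ℂ) {N : ℕ}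
    (M : Fin N → Fin N → R) : Prop where
  col : ∀ i j a, i < j → M i a * M j a = q • (M j a * M i a)
  row : ∀ i a b, a < b → M i a * M i b = q • (M i b * M i a)
  comm : ∀ i j a b, i < j → b < a → M i a * M j b = M j b * M i a
  cross : ∀ i j a b, i < j → a < b →
    M i a * M j b - M j b * M i a = (q - q⁻¹) • (M j a * M i b)

/-- Quantum exterior relations. -/
structure IsQExt {R : Type*} [Ring R] [Algebra ℂ R] (q : ℂ) {N : ℕ} (x : Fin N → R) : Prop where
  sq : ∀ i, x i * x i = 0
  anti : ∀ i j, i < j → x j * x i = (-q) • (x i * x j)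

section
variable {R : Type*} [Ring R] [Algebra ℂ R] {q : ℂ} {N : ℕ}

/-- inversions of a list -/
def linv : List (Fin N) → ℕ
  | [] => 0
  | a :: l => l.countP (· < a) + linv l

theorem IsQExt.insert {x : Fin N → R} (h : IsQExt q x) (a : Fin N) :
    ∀ l : List (Fin N), l.Pairwise (· < ·) → x a * (l.map x).prod =
      if a ∈ l then 0 else (-q) ^ (l.countP (· < a)) • ((l.orderedInsert (· ≤ ·) a).map x).prod := by
  intro l
  induction l with
  | nil => simp
  | cons b l ih =>
    intro hl
    rw [List.pairwise_cons] at hl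
    rcases lt_trichotomy a b with hab | hab | hab
    · have h1 : a ∉ b :: l := by
        intro hm
        rcases List.mem_cons.1 hm with rfl | hm
        · exact lt_irrefl _ hab
        · exact lt_asymm hab (hl.1 _ hm)
      have h2 : (b :: l).countP (· < a) = 0 := by
        rw [List.countP_eq_zero]
        intro c hc
        rcases List.mem_cons.1 hc with rfl | hc
        · simpa using hab.le
        · simpa using (hab.trans (hl.1 _ hc)).le
      rw [if_neg h1, h2, List.orderedInsert_cons, if_pos hab.le]
      simp
    · subst hab
      simp [← mul_assoc, h.sq]
    · have := ih hl.2
      have e : x a * ((b :: l).map x).prod = (-q) • (x b * (x a * (l.map x).prod)) := by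
        simp only [List.map_cons, List.prod_cons]
        rw [← mul_assoc, h.anti b a hab, smul_mul_assoc, mul_assoc]
      rw [e, this]
      have hne : a ≠ b := hab.ne'
      by_cases hm : a ∈ l
      · simp [hm]
      · rw [if_neg hm, if_neg (by simp [hm, hne])]
        rw [List.orderedInsert_cons, if_neg (not_le.2 hab), List.countP_cons_of_pos (by simpa using hab)]
        simp only [List.map_cons, List.prod_cons, mul_smul_comm, smul_smul, pow_succ']

theorem pairwise_insertionSort {l : List (Fin N)} (hl : l.Nodup) :
    (l.insertionSort (· ≤ ·)).Pairwise (· < ·) := by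
  have h1 := List.pairwise_insertionSort (· ≤ · : Fin N → Fin N → Prop) l
  have h2 : (l.insertionSort (· ≤ ·)).Nodup := (List.perm_insertionSort _ l).nodup_iff.2 hl
  have := h1.and h2
  exact this.imp fun h => lt_of_le_of_ne h.1 h.2

theorem IsQExt.sort {x : Fin N → R} (h : IsQExt q x) :
    ∀ l : List (Fin N), l.Nodup → (l.map x).prod =
      (-q) ^ linv l • ((l.insertionSort (· ≤ ·)).map x).prod := by
  intro l
  induction l with
  | nil => simp [linv]
  | cons a l ih =>
    intro hl
    rw [List.nodup_cons] at hl
    rw [List.map_cons, List.prod_cons, ih hl.2, mul_smul_comm, h.insert a _ (pairwise_insertionSort hl.2),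
      if_neg (by simpa using hl.1), smul_smul, List.insertionSort_cons,
      (List.perm_insertionSort (· ≤ ·) l).countP_eq, linv, pow_add, mul_comm]

theorem IsQExt.not_nodup {x : Fin N → R} (h : IsQExt q x) :
    ∀ l : List (Fin N), ¬ l.Nodup → (l.map x).prod = 0 := by
  intro l
  induction l with
  | nil => simp
  | cons a l ih =>
    intro hl
    rw [List.map_cons, List.prod_cons]
    by_cases hn : l.Nodup
    · have ha : a ∈ l := by
        by_contra ha
        exact hl (List.nodup_cons.2 ⟨ha, hn⟩)
      rw [h.sort l hn, mul_smul_comm, h.insert a _ (pairwise_insertionSort hn),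
        if_pos (by simpa using ha), smul_zero]
    · rw [ih hn, mul_zero]

theorem countP_ofFn_eq {α : Type*} (p : α → Bool) : ∀ {k : ℕ} (g : Fin k → α),
    (List.ofFn g).countP p = ∑ j : Fin k, if p (g j) then 1 else 0
  | 0, _ => by simp
  | k + 1, g => by
    rw [List.ofFn_succ, List.countP_cons, countP_ofFn_eq p, Fin.sum_univ_succ, add_comm]

theorem linv_ofFn {k : ℕ} (f : Fin k → Fin N) : linv (List.ofFn f) =
    (Finset.univ.filter fun p : Fin k × Fin k => p.1 < p.2 ∧ f p.2 < f p.1).card := by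
  induction k with
  | zero => simp [linv]
  | succ k ih =>
    rw [List.ofFn_succ, linv, ih, countP_ofFn_eq]
    simp only [Finset.card_filter, Fintype.sum_prod_type]
    rw [Fin.sum_univ_succ]
    simp only [Fin.sum_univ_succ]
    simp

theorem linv_ofFn_perm {k : ℕ} (g : Fin k → Fin N) (hg : StrictMono g) (s : Equiv.Perm (Fin k)) :
    linv (List.ofFn fun p => g (s p)) = invLength s := by
  rw [linv_ofFn, invLength]
  simp only [hg.lt_iff_lt]

theorem sort_ofFn_perm {k : ℕ} (g : Fin k → Fin N) (hg : StrictMono g) (s : Equiv.Perm (Fin k)) :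
    (List.ofFn fun p => g (s p)).insertionSort (· ≤ ·) = List.ofFn g := by
  refine List.Perm.eq_of_pairwise' (r := (· ≤ ·)) ?_ ?_ ?_
  · exact List.pairwise_insertionSort _ _
  · rw [List.pairwise_ofFn]
    intro i j hij
    exact (hg hij).le
  · refine (List.perm_insertionSort _ _).trans ?_
    exact Equiv.Perm.ofFn_comp_perm s g

theorem IsQExt.perm {x : Fin N → R} (h : IsQExt q x) {k : ℕ} (g : Fin k → Fin N)
    (hg : StrictMono g) (s : Equiv.Perm (Fin k)) :
    (List.ofFn fun p => x (g (s p))).prod = (-q) ^ invLength s • (List.ofFn fun p => x (g p)).prod := by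
  have h1 := h.sort (List.ofFn fun p => g (s p))
    (List.nodup_ofFn.2 (hg.injective.comp s.injective))
  rw [linv_ofFn_perm g hg, sort_ofFn_perm g hg, List.map_ofFn, List.map_ofFn] at h1
  exact h1

theorem IsQExt.not_inj {x : Fin N → R} (h : IsQExt q x) {k : ℕ} (f : Fin k → Fin N)
    (hf : ¬ Function.Injective f) : (List.ofFn fun p => x (f p)).prod = 0 := by
  have h1 := h.not_nodup (List.ofFn f) (by rwa [List.nodup_ofFn])
  rw [List.map_ofFn] at h1
  exact h1

/-- Expansion of a product of linear combinations. -/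
theorem prod_expand {c : Fin N → Fin N → R} {x : Fin N → R} (hc : ∀ i j l, Commute (x l) (c i j)) :
    ∀ {k : ℕ} (r : Fin k → Fin N),
    (List.ofFn fun p => ∑ j, c (r p) j * x j).prod =
      ∑ f : Fin k → Fin N, (List.ofFn fun p => c (r p) (f p)).prod * (List.ofFn fun p => x (f p)).prod
  | 0, r => by simp
  | k + 1, r => by
    rw [List.ofFn_succ, List.prod_cons, prod_expand hc (fun p => r p.succ),
      ← (Fin.consEquiv fun _ => Fin N).sum_comp, Fintype.sum_prod_type, Finset.sum_mul]
    refine Finset.sum_congr rfl fun j _ => ?_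
    rw [Finset.mul_sum]
    refine Finset.sum_congr rfl fun f _ => ?_
    simp only [List.ofFn_succ, List.prod_cons, Fin.consEquiv_apply, Fin.cons_zero, Fin.cons_succ]
    have : Commute (x j) (List.ofFn fun p : Fin k => c (r p.succ) (f p)).prod := by
      refine Commute.list_prod_right _ _ ?_
      intro y hy
      obtain ⟨p, rfl⟩ := List.mem_ofFn.1 hy
      exact hc _ _ _
    rw [mul_assoc, mul_assoc, ← mul_assoc (x j), this.eq]
    simp only [mul_assoc]

theorem sum_inj {E : Type*} [AddCommMonoid E] {n : ℕ} (F : (Fin n → Fin n) → E)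
    (hF : ∀ f, ¬ Function.Injective f → F f = 0) :
    ∑ f, F f = ∑ s : Equiv.Perm (Fin n), F s := by
  classical
  symm
  refine Finset.sum_of_injOn (fun s : Equiv.Perm (Fin n) => (s : Fin n → Fin n)) ?_ ?_ ?_ ?_
  · intro s _ t _ h
    exact DFunLike.coe_injective h
  · intro s _; simp
  · intro f _ hf
    refine hF f fun hi => hf ?_
    exact ⟨Equiv.ofBijective f (Finite.injective_iff_bijective.1 hi), by simp, rfl⟩
  · intro s _; rfl

theorem IsQExt.comb {c : Fin N → Fin N → R} {x : Fin N → R} (hx : IsQExt q x)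
    (hM : IsQMatrix q c) (hq : q ≠ 0) (hc : ∀ i j l, Commute (x l) (c i j)) :
    IsQExt q (fun i => ∑ j, c i j * x j) := by
  have key : ∀ i j, (∑ k, c i k * x k) * (∑ k, c j k * x k) =
      ∑ k, ∑ l, (c i k * c j l) * (x k * x l) := by
    intro i j
    rw [Finset.sum_mul]
    refine Finset.sum_congr rfl fun k _ => ?_
    rw [Finset.mul_sum]
    refine Finset.sum_congr rfl fun l _ => ?_
    rw [mul_assoc, ← mul_assoc (x k), (hc j l k).eq]; simp only [mul_assoc]
  have key2 : ∀ d : Fin N → Fin N → R, (∀ k l, k < l → d k l = q • d l k) →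
      ∑ k, ∑ l, d k l * (x k * x l) = 0 := by
    intro d hd
    have e1 : ∑ k, ∑ l, d k l * (x k * x l) =
        ∑ k, ∑ l, ((if k < l then d k l * (x k * x l) else 0) +
          (if l < k then d k l * (x k * x l) else 0)) := by
      refine Finset.sum_congr rfl fun k _ => Finset.sum_congr rfl fun l _ => ?_
      rcases lt_trichotomy k l with h | h | h
      · simp [h, h.not_gt]
      · subst h; simp [hx.sq]
      · simp [h, h.not_gt]
    have e2 : ∑ k, ∑ l, (if l < k then d k l * (x k * x l) else 0) =
        ∑ k, ∑ l, (if k < l then d l k * (x l * x k) else 0) := Finset.sum_comm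
    rw [e1]
    simp only [Finset.sum_add_distrib]
    rw [e2]
    simp only [← Finset.sum_add_distrib]
    refine Finset.sum_eq_zero fun k _ => Finset.sum_eq_zero fun l _ => ?_
    split_ifs with h
    · rw [hd k l h, hx.anti k l h]
      simp
    · simp
  constructor
  · intro i
    rw [key]
    exact key2 _ fun k l h => hM.row i k l h
  · intro i j hij
    rw [key, key, ← sub_eq_zero, Finset.smul_sum, ← Finset.sum_sub_distrib]
    simp only [Finset.smul_sum, ← Finset.sum_sub_distrib, ← smul_mul_assoc, ← sub_mul]
    refine key2 (fun k l => c j k * c i l - (-q) • c i k * c j l) fun k l h => ?_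
    have h1 := hM.cross i j k l hij h
    have h2 := hM.comm i j l k hij h
    have h3 : c i k * c j l = c j l * c i k + (q - q⁻¹) • (c j k * c i l) := by rw [← h1]; abel
    simp only [smul_mul_assoc]
    rw [h3, h2, ← sub_eq_zero]
    simp only [smul_add, smul_sub, smul_smul, neg_smul]
    match_scalars <;> field_simp <;> ring

theorem IsQExt.det {c : Fin N → Fin N → R} {x : Fin N → R} (hx : IsQExt q x)
    (hc : ∀ i j l, Commute (x l) (c i j)) :
    (List.ofFn fun i => ∑ j, c i j * x j).prod = qDet q c * (List.ofFn x).prod := by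
  have h0 := prod_expand hc id
  simp only [id] at h0
  rw [h0, sum_inj]
  · rw [qDet, qMinor, Finset.sum_mul]
    refine Finset.sum_congr rfl fun s _ => ?_
    have := hx.perm id strictMono_id s
    simp only [id] at this ⊢
    rw [this, mul_smul_comm, smul_mul_assoc]
  · intro f hf
    rw [hx.not_inj f hf, mul_zero]


theorem IsQMatrix.map {S : Type*} [Ring S] [Algebra ℂ S] (f : R →ₐ[ℂ] S) {M : Fin N → Fin N → R}
    (h : IsQMatrix q M) : IsQMatrix q (fun i j => f (M i j)) where
  col i j a hij := by simp only [← map_mul, ← map_smul, h.col i j a hij]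
  row i a b hab := by simp only [← map_mul, ← map_smul, h.row i a b hab]
  comm i j a b hij hab := by simp only [← map_mul, h.comm i j a b hij hab]
  cross i j a b hij hab := by
    simp only [← map_mul, ← map_smul, ← map_sub, h.cross i j a b hij hab]

theorem IsQMatrix.transpose {M : Fin N → Fin N → R} (h : IsQMatrix q M) :
    IsQMatrix q (fun i j => M j i) where
  col i j a hij := h.row _ _ _ hij
  row i a b hab := h.col _ _ _ hab
  comm i j a b hij hab := (h.comm b a j i hab hij).symm
  cross i j a b hij hab := by
    rw [h.cross a b i j hab hij, h.comm a b j i hab hij]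

theorem map_qMinor {S : Type*} [Ring S] [Algebra ℂ S] (f : R →ₐ[ℂ] S) (M : Fin N → Fin N → R)
    {k : ℕ} (r c : Fin k → Fin N) : f (qMinor q M r c) = qMinor q (fun i j => f (M i j)) r c := by
  simp only [qMinor, map_sum, map_smul, map_list_prod, List.map_ofFn]
  rfl

theorem map_qMinor_det {S : Type*} [Ring S] [Algebra ℂ S] (f : R →ₐ[ℂ] S) (M : Fin N → Fin N → R) :
    f (qDet q M) = qDet q (fun i j => f (M i j)) := map_qMinor f M id id

variable (R q N) in
/-- Creation operators on the Fock space of the quantum exterior algebra. -/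
noncomputable def fock (i : Fin N) : Matrix (Finset (Fin N)) (Finset (Fin N)) R :=
  fun S T => if i ∉ T ∧ S = insert i T then
    algebraMap ℂ R ((-q) ^ (T.filter (· < i)).card) else 0

variable (R N) in
/-- Scalar matrices. -/
noncomputable def scal : R →ₐ[ℂ] Matrix (Finset (Fin N)) (Finset (Fin N)) R :=
  { Matrix.scalar (Finset (Fin N)) with
    commutes' := fun c => by
      ext S T
      simp [Matrix.algebraMap_matrix_apply, Matrix.diagonal_apply] }

theorem scal_mul (a : R) (Y : Matrix (Finset (Fin N)) (Finset (Fin N)) R) (S T) :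
    (scal R N a * Y) S T = a * Y S T := by
  change (Matrix.diagonal (fun _ : Finset (Fin N) => a) * Y : Matrix _ _ R) S T = _
  rw [Matrix.diagonal_mul]

theorem mul_scal (a : R) (Y : Matrix (Finset (Fin N)) (Finset (Fin N)) R) (S T) :
    (Y * scal R N a) S T = Y S T * a := by
  change (Y * Matrix.diagonal (fun _ : Finset (Fin N) => a) : Matrix _ _ R) S T = _
  rw [Matrix.mul_diagonal]

theorem fock_scal (i : Fin N) (a : R) : Commute (fock R q N i) (scal R N a) := by
  ext S T
  rw [scal_mul, mul_scal, fock]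
  split_ifs
  · exact Algebra.commutes _ _
  · simp

theorem mul_fock (i : Fin N) (Y : Matrix (Finset (Fin N)) (Finset (Fin N)) R) (S T) :
    (Y * fock R q N i) S T =
      if i ∉ T then ((-q) ^ (T.filter (· < i)).card) • Y S (insert i T) else 0 := by
  rw [Matrix.mul_apply]
  by_cases h : i ∈ T
  · simp [fock, h]
  · rw [Finset.sum_eq_single (insert i T)]
    · rw [fock, if_pos ⟨h, rfl⟩, if_pos h, Algebra.smul_def, Algebra.commutes]
    · intro U _ hU
      simp [fock, h, hU]
    · simp

theorem fock_ext : IsQExt q (fock R q N) := by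
  constructor
  · intro i
    ext S T
    rw [mul_fock]
    by_cases h : i ∈ T <;> simp [fock, h]
  · intro i j hij
    ext S T
    rw [mul_fock, Matrix.smul_apply, mul_fock]
    have hne : j ≠ i := hij.ne'
    by_cases hi : i ∈ T
    · by_cases hj : j ∈ T <;> simp [fock, hi, hj]
    by_cases hj : j ∈ T
    · simp [fock, hi, hj]
    have e1 : (insert i T).filter (· < j) = insert i (T.filter (· < j)) := by
      rw [Finset.filter_insert, if_pos hij]
    have e2 : (insert j T).filter (· < i) = T.filter (· < i) := by
      rw [Finset.filter_insert, if_neg hij.not_gt]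
    by_cases hS : S = insert j (insert i T)
    · have hS' : S = insert i (insert j T) := by rw [hS, Finset.insert_comm]
      have c1 : fock R q N j S (insert i T) = algebraMap ℂ R ((-q) ^ ((T.filter (· < j)).card + 1)) := by
        rw [fock, if_pos ⟨by simp [hj, hne], hS⟩, e1, Finset.card_insert_of_notMem (by simp [hi])]
      have c2 : fock R q N i S (insert j T) = algebraMap ℂ R ((-q) ^ ((T.filter (· < i)).card)) := by
        rw [fock, if_pos ⟨by simp [hi, hne.symm], hS'⟩, e2]
      rw [if_pos hi, if_pos hj, c1, c2]
      simp only [Algebra.smul_def, ← map_mul]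
      congr 1
      ring
    · have hS' : ¬ S = insert i (insert j T) := by rwa [Finset.insert_comm]
      simp [fock, hS, hS']

theorem fock_mul_single (i : Fin N) (Y : Matrix (Finset (Fin N)) (Finset (Fin N)) R) (S U T)
    (hi : i ∉ U) (hS : S = insert i U) :
    (fock R q N i * Y) S T = ((-q) ^ (U.filter (· < i)).card) • Y U T := by
  rw [Matrix.mul_apply, Finset.sum_eq_single U]
  · simp [fock, hi, hS, Algebra.smul_def]
  · intro V _ hV
    rw [fock, if_neg, zero_mul]
    rintro ⟨h1, h2⟩
    apply hV
    rw [← Finset.erase_insert h1, ← h2, hS, Finset.erase_insert hi]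
  · simp

theorem fock_sorted : ∀ l : List (Fin N), l.Pairwise (· < ·) → ∀ S,
    (l.map (fock R q N)).prod S ∅ = if S = l.toFinset then 1 else 0
  | [], _, S => by
    simp only [List.map_nil, List.prod_nil, Matrix.one_apply, List.toFinset_nil]
    congr
  | a :: l, hl, S => by
    rw [List.pairwise_cons] at hl
    have ha : a ∉ l.toFinset := by
      intro h
      exact lt_irrefl _ (hl.1 a (by simpa using h))
    have ih := fock_sorted l hl.2
    rw [List.map_cons, List.prod_cons, Matrix.mul_apply, Finset.sum_eq_single l.toFinset]
    · have h0 : l.toFinset.filter (· < a) = ∅ := by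
        rw [Finset.filter_eq_empty_iff]
        intro b hb
        exact (hl.1 b (by simpa using hb)).not_gt
      rw [ih, if_pos rfl, mul_one, fock, h0, List.toFinset_cons]
      simp [show a ∉ l by simpa using ha]
    · intro U _ hU
      rw [ih, if_neg hU, mul_zero]
    · simp

theorem fock_word {k : ℕ} (f : Fin k → Fin N) (S) :
    (List.ofFn fun p => fock R q N (f p)).prod S ∅ =
      if Function.Injective f ∧ S = Finset.univ.image f then
        algebraMap ℂ R ((-q) ^ linv (List.ofFn f)) else 0 := by
  have e : (List.ofFn fun p => fock R q N (f p)) = (List.ofFn f).map (fock R q N) := by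
    rw [List.map_ofFn]; rfl
  by_cases hf : Function.Injective f
  · rw [e, fock_ext.sort _ (List.nodup_ofFn.2 hf), Matrix.smul_apply, fock_sorted _
      (pairwise_insertionSort (List.nodup_ofFn.2 hf))]
    have : ((List.ofFn f).insertionSort (· ≤ ·)).toFinset = Finset.univ.image f := by
      ext a
      simp [List.mem_ofFn]
    rw [this]
    by_cases hS : S = Finset.univ.image f <;> simp [hS, hf, Algebra.smul_def]
  · rw [fock_ext.not_inj f hf]
    simp [hf]

/-- Minors are the matrix elements of products in the quantum exterior algebra. -/
theorem coeff_minor (M : Fin N → Fin N → R) {k : ℕ} (r g : Fin k → Fin N) (hg : StrictMono g) :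
    (List.ofFn fun p => ∑ j, scal R N (M (r p) j) * fock R q N j).prod (Finset.univ.image g) ∅ =
      qMinor q M r g := by
  classical
  rw [prod_expand (c := fun i j => scal R N (M i j)) (fun i j l => fock_scal l _) r,
    Matrix.sum_apply, qMinor]
  symm
  refine Finset.sum_of_injOn (fun s : Equiv.Perm (Fin k) => g ∘ s) ?_ ?_ ?_ ?_
  · intro s _ t _ h
    ext p
    have := congrFun h p
    exact congrArg Fin.val (hg.injective this)
  · intro s _; simp
  · intro f _ hf
    have e : (List.ofFn fun p => scal R N (M (r p) (f p))) =
      (List.ofFn fun p => M (r p) (f p)).map (scal R N) := by rw [List.map_ofFn]; rfl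
    rw [e, ← map_list_prod, scal_mul, fock_word, if_neg, mul_zero]
    rintro ⟨h1, h2⟩
    apply hf
    have h3 : ∀ p, ∃ s, g s = f p := by
      intro p
      have : f p ∈ Finset.univ.image g := by rw [h2]; simp
      simpa using this
    choose s hs using h3
    have hsi : Function.Injective s := by
      intro a b hab
      apply h1
      rw [← hs, ← hs, hab]
    refine ⟨Equiv.ofBijective s (Finite.injective_iff_bijective.1 hsi), by simp, ?_⟩
    funext p
    exact hs p
  · intro s _
    have e : (List.ofFn fun p => scal R N (M (r p) ((g ∘ s) p))) =
      (List.ofFn fun p => M (r p) (g (s p))).map (scal R N) := by rw [List.map_ofFn]; rfl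
    rw [e, ← map_list_prod, scal_mul, fock_word, if_pos]
    · have := linv_ofFn_perm g hg s
      simp only [Function.comp_def]
      rw [this, Algebra.smul_def, Algebra.commutes]
    · refine ⟨hg.injective.comp s.injective, ?_⟩
      rw [← Finset.image_image, Finset.image_univ_equiv]

/-- All indices except `i`, in increasing order. -/
def skip {N : ℕ} (i : Fin N) (p : Fin (N - 1)) : Fin N :=
  ⟨if p.1 < i.1 then p.1 else p.1 + 1, by split_ifs <;> omega⟩

theorem skip_succ {n : ℕ} (i : Fin (n + 1)) : skip i = i.succAbove := by
  funext p
  ext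
  simp only [skip, Fin.succAbove, Fin.lt_def, Fin.val_castSucc]
  split_ifs <;> rfl

theorem skip_strictMono {N : ℕ} (i : Fin N) : StrictMono (skip i) := by
  intro a b h
  simp only [skip, Fin.lt_def] at *
  split_ifs <;> omega

theorem image_skip {N : ℕ} (i : Fin N) : Finset.univ.image (skip i) = {i}ᶜ := by
  cases N with
  | zero => exact i.elim0
  | succ n => rw [skip_succ, Fin.image_succAbove_univ]

theorem coeff_det (M : Fin N → Fin N → R) (r : Fin N → Fin N) :
    (List.ofFn fun p => ∑ j, scal R N (M (r p) j) * fock R q N j).prod Finset.univ ∅ =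
      qMinor q M r id := by
  rw [← coeff_minor M r id strictMono_id, Finset.image_id]

theorem minor_perm {M : Fin N → Fin N → R} (hM : IsQMatrix q M) (hq : q ≠ 0)
    (w : Equiv.Perm (Fin N)) : qMinor q M w id = (-q) ^ invLength w • qDet q M := by
  have hx : IsQExt q (fun i => ∑ j, scal R N (M i j) * fock R q N j) :=
    fock_ext.comb (hM.map (scal R N)) hq (fun i j l => fock_scal l _)
  have := hx.perm id strictMono_id w
  simp only [id] at this
  rw [← coeff_det, this, Matrix.smul_apply]
  exact congrArg _ (coeff_det M id)

theorem laplace {M : Fin N → Fin N → R} (hM : IsQMatrix q M) (hq : q ≠ 0) (i j : Fin N) :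
    ∑ k, M i k * ((-q) ^ (k : ℕ) • qMinor q M (skip j) (skip k)) =
      if i = j then (-q) ^ (j : ℕ) • qDet q M else 0 := by
  have hx : IsQExt q (fun i => ∑ j, scal R N (M i j) * fock R q N j) :=
    fock_ext.comb (hM.map (scal R N)) hq (fun i j l => fock_scal l _)
  set y := (fun i => ∑ j, scal R N (M i j) * fock R q N j) with hy
  have e1 : (y i * (List.ofFn fun p => y (skip j p)).prod) Finset.univ ∅ =
      ∑ k, M i k * ((-q) ^ (k : ℕ) • qMinor q M (skip j) (skip k)) := by
    conv_lhs => rw [hy]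
    rw [Finset.sum_mul, Matrix.sum_apply]
    refine Finset.sum_congr rfl fun k _ => ?_
    rw [mul_assoc, scal_mul, fock_mul_single k _ _ ({k}ᶜ) _ (by simp) (by ext; simp), ← image_skip k,
      coeff_minor M _ _ (skip_strictMono k), image_skip]
    congr 3
    have : ({k}ᶜ : Finset (Fin N)).filter (· < k) = Finset.univ.filter (· < k) := by
      ext a; simp +contextual [ne_of_lt]
    rw [this]
    have h3 : Finset.univ.filter (· < k) = Finset.Iio k := by ext; simp
    rw [h3, Fin.card_Iio]
  rw [← e1]
  have e2 : (List.ofFn fun p => y (skip j p)) = (List.ofFn (skip j)).map y := by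
    rw [List.map_ofFn]; rfl
  rw [e2, hx.insert i _ (by rw [List.pairwise_ofFn]; exact fun a b h => skip_strictMono j h)]
  have hmem : i ∈ List.ofFn (skip j) ↔ i ≠ j := by
    have : i ∈ List.ofFn (skip j) ↔ i ∈ Finset.univ.image (skip j) := by
      simp [List.mem_ofFn]
    rw [this, image_skip]; simp
  by_cases hij : i = j
  · subst hij
    rw [if_neg (by simp [hmem]), if_pos rfl]
    have h1 : (List.ofFn (skip i)).orderedInsert (· ≤ ·) i = List.ofFn id := by
      refine List.Perm.eq_of_pairwise' (r := (· ≤ ·)) ?_ ?_ ?_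
      · refine List.Pairwise.orderedInsert _ _ ?_
        rw [List.pairwise_ofFn]; exact fun a b h => (skip_strictMono i h).le
      · rw [List.pairwise_ofFn]; exact fun a b h => h.le
      · refine (List.perm_of_nodup_nodup_toFinset_eq ?_ ?_ ?_)
        · rw [(List.perm_orderedInsert _ _ _).nodup_iff, List.nodup_cons]
          exact ⟨by simp [hmem], List.nodup_ofFn.2 (skip_strictMono i).injective⟩
        · exact List.nodup_ofFn.2 Function.injective_id
        · ext a
          have : a ∈ List.ofFn (skip i) ↔ a ∈ Finset.univ.image (skip i) := by
            simp [List.mem_ofFn]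
          rw [List.mem_toFinset, List.mem_toFinset, List.mem_orderedInsert, this, image_skip]
          simp [List.mem_ofFn, em]
    have h2 : (List.ofFn (skip i)).countP (· < i) = i := by
      rw [countP_ofFn_eq]
      have : ∀ p : Fin (N - 1), (decide (skip i p < i) = true) ↔ p.1 < i.1 := by
        intro p
        rw [decide_eq_true_iff, Fin.lt_def, skip]
        simp only []
        split_ifs <;> omega
      simp only [this]
      rw [← Finset.card_filter]
      cases N with
      | zero => exact i.elim0
      | succ n =>
        refine (Fin.card_filter_val_lt (n := n) (m := i.1)).trans ?_
        omega
    rw [h1, h2, Matrix.smul_apply, List.map_ofFn]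
    exact congrArg _ (coeff_det M id)
  · rw [if_pos (hmem.2 hij), if_neg hij]
    rfl


/-- The braiding of the vector representation, acting on the first pair of indices. -/
noncomputable def heckeL {E : Type*} [AddCommGroup E] [Module ℂ E] (q : ℂ)
    (Y : Fin N → Fin N → E) (i j : Fin N) : E :=
  if i = j then q • Y i j else if i < j then Y j i + (q - q⁻¹) • Y i j else Y j i

theorem hecke_iff {M : Fin N → Fin N → R} (hq : q ≠ 0) : IsQMatrix q M ↔
    ∀ i j k l, heckeL q (fun i j => M i k * M j l) i j = heckeL q (fun k l => M i k * M j l) k l := by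
  constructor
  · intro h i j k l
    have hq2 : q * q⁻¹ = 1 := mul_inv_cancel₀ hq
    have hq3 : q⁻¹ * q = 1 := inv_mul_cancel₀ hq
    simp only [heckeL]
    rcases lt_trichotomy i j with hij | rfl | hij <;> rcases lt_trichotomy k l with hkl | rfl | hkl
    · simp [hij, hij.ne, hkl, hkl.ne, h.comm i j l k hij hkl]
    · simp only [hij, hij.ne, if_true, if_false]
      rw [h.col i j k hij]
      simp only [smul_smul, sub_mul, hq3]
      module
    · simp only [hij, hij.ne, hkl.ne', hkl.not_gt, if_true, if_false]
      have := h.cross i j l k hij hkl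
      rw [h.comm i j k l hij hkl, ← this]; abel
    · simp only [hkl, hkl.ne, if_true, if_false]
      rw [h.row i k l hkl]
      simp only [smul_smul, sub_mul, hq3]
      module
    · simp
    · simp only [hkl.ne', hkl.not_gt, if_true, if_false]
      rw [h.row i l k hkl]
    · simp only [hij.ne', hij.not_gt, hkl, hkl.ne, if_true, if_false]
      have := h.cross j i k l hij hkl
      rw [← this]; abel
    · simp only [hij.ne', hij.not_gt, if_true, if_false]
      rw [h.col j i k hij]
    · simp only [hij.ne', hij.not_gt, hkl.ne', hkl.not_gt, if_false]
      exact h.comm j i k l hij hkl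
  · intro h
    have hcomm : ∀ i j a b, i < j → b < a → M i a * M j b = M j b * M i a := by
      intro i j a b hij hab
      have := h j i b a
      simp only [heckeL, hij.ne', hij.not_gt, hab, hab.ne, if_true, if_false] at this
      have h2 := h i j a b
      simp only [heckeL, hij.ne, hij, hab.ne', hab.not_gt, if_true, if_false] at h2
      have h3 := h i j b a
      simp only [heckeL, hij, hij.ne, hab, hab.ne, if_true, if_false] at h3
      exact (add_right_cancel h3).symm
    constructor
    · intro i j a hij
      have := h j i a a
      simp only [heckeL, hij.ne', hij.not_gt, if_true, if_false] at this
      exact this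
    · intro i a b hab
      have := h i i b a
      simp only [heckeL, hab.ne', hab.not_gt, if_true, if_false] at this
      exact this.symm
    · exact hcomm
    · intro i j a b hij hab
      have := h j i a b
      simp only [heckeL, hij.ne', hij.not_gt, hab.ne, hab, if_true, if_false] at this
      rw [this]; abel

theorem heckeL_sum {E ι : Type*} [AddCommGroup E] [Module ℂ E] (s : Finset ι)
    (Y : ι → Fin N → Fin N → E) (i j : Fin N) :
    heckeL q (fun i j => ∑ t ∈ s, Y t i j) i j = ∑ t ∈ s, heckeL q (Y t) i j := by
  simp only [heckeL]
  split_ifs <;> simp [Finset.smul_sum, Finset.sum_add_distrib]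

theorem heckeL_mul_right (Y : Fin N → Fin N → R) (z : R) (i j : Fin N) :
    heckeL q (fun i j => Y i j * z) i j = heckeL q Y i j * z := by
  simp only [heckeL]
  split_ifs <;> simp [add_mul]

theorem heckeL_mul_left (Y : Fin N → Fin N → R) (z : R) (i j : Fin N) :
    heckeL q (fun i j => z * Y i j) i j = z * heckeL q Y i j := by
  simp only [heckeL]
  split_ifs <;> simp [mul_add]

/-- The Hecke operator is symmetric. -/
theorem heckeL_symm (Y Z : Fin N → Fin N → R) :
    ∑ a, ∑ b, heckeL q Y a b * Z a b = ∑ a, ∑ b, Y a b * heckeL q Z a b := by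
  have e : ∀ a b, heckeL q Y a b * Z a b - Y a b * heckeL q Z a b =
      (if a = b then 0 else Y b a * Z a b) - (if a = b then 0 else Y a b * Z b a) := by
    intro a b
    simp only [heckeL]
    split_ifs <;> simp [mul_add, add_mul]
  rw [← sub_eq_zero]
  simp only [← Finset.sum_sub_distrib, e]
  simp only [Finset.sum_sub_distrib]
  rw [sub_eq_zero, Finset.sum_comm]
  refine Finset.sum_congr rfl fun a _ => Finset.sum_congr rfl fun b _ => ?_
  simp only [eq_comm]

/-- The product of two quantum matrices with commuting entries is a quantum matrix. -/
theorem IsQMatrix.mul {M M' : Fin N → Fin N → R} (h : IsQMatrix q M) (h' : IsQMatrix q M')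
    (hq : q ≠ 0) (hc : ∀ i j k l, Commute (M i j) (M' k l)) :
    IsQMatrix q (fun i j => ∑ k, M i k * M' k j) := by
  rw [hecke_iff hq] at *
  intro i j k l
  have e : ∀ i j k l, (∑ a, M i a * M' a k) * (∑ b, M j b * M' b l) =
      ∑ a, ∑ b, (M i a * M j b) * (M' a k * M' b l) := by
    intro i j k l
    rw [Finset.sum_mul]
    refine Finset.sum_congr rfl fun a _ => ?_
    rw [Finset.mul_sum]
    refine Finset.sum_congr rfl fun b _ => ?_
    rw [mul_assoc, ← mul_assoc (M' a k), ← (hc j b a k).eq]; simp only [mul_assoc]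
  simp only [e]
  simp only [heckeL_sum, heckeL_mul_right, heckeL_mul_left]
  simp only [h i j]
  rw [heckeL_symm]
  simp only [h']

/-- The inverse of a quantum matrix satisfies the opposite relations. -/
theorem hecke_inv {M X : Fin N → Fin N → R} (h : IsQMatrix q M) (hq : q ≠ 0)
    (hl : ∀ i j, ∑ k, X i k * M k j = if i = j then 1 else 0)
    (hr : ∀ i j, ∑ k, M i k * X k j = if i = j then 1 else 0) :
    ∀ i j k l, heckeL q (fun i j => X j l * X i k) i j = heckeL q (fun k l => X j l * X i k) k l := by
  rw [hecke_iff hq] at h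
  -- cancellation on either side
  have cl : ∀ (Y : Fin N → Fin N → R) i j,
      ∑ a, ∑ b, (X j b * X i a) * (∑ c, ∑ d, (M a c * M b d) * Y c d) = Y i j := by
    intro Y i j
    have e : ∀ a b, (X j b * X i a) * (∑ c, ∑ d, (M a c * M b d) * Y c d) =
        ∑ c, ∑ d, X j b * ((X i a * M a c) * (M b d * Y c d)) := by
      intro a b
      simp only [Finset.mul_sum, mul_assoc]
    simp only [e]
    rw [Finset.sum_comm]
    have e2 : ∀ b, ∑ a, ∑ c, ∑ d, X j b * ((X i a * M a c) * (M b d * Y c d)) =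
        ∑ d, X j b * M b d * Y i d := by
      intro b
      rw [Finset.sum_comm]
      have : ∀ c, ∑ a, ∑ d, X j b * ((X i a * M a c) * (M b d * Y c d)) =
          ∑ d, X j b * ((if i = c then 1 else 0) * (M b d * Y c d)) := by
        intro c
        rw [Finset.sum_comm]
        refine Finset.sum_congr rfl fun d _ => ?_
        rw [← Finset.mul_sum, ← Finset.sum_mul, hl]
      simp only [this]
      rw [Finset.sum_comm]
      refine Finset.sum_congr rfl fun d _ => ?_
      simp [mul_assoc]
    simp only [e2]
    rw [Finset.sum_comm]
    simp [← Finset.sum_mul, hl]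
  have cr : ∀ (Y : Fin N → Fin N → R) k l,
      ∑ c, ∑ d, (∑ a, ∑ b, Y a b * (M a c * M b d)) * (X d l * X c k) = Y k l := by
    intro Y k l
    have e : ∀ c d, (∑ a, ∑ b, Y a b * (M a c * M b d)) * (X d l * X c k) =
        ∑ a, ∑ b, Y a b * (M a c * ((M b d * X d l) * X c k)) := by
      intro a b
      simp only [Finset.sum_mul, mul_assoc]
    simp only [e]
    have e2 : ∀ c, ∑ d, ∑ a, ∑ b, Y a b * (M a c * ((M b d * X d l) * X c k)) =
        ∑ a, Y a l * (M a c * X c k) := by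
      intro c
      rw [Finset.sum_comm]
      refine Finset.sum_congr rfl fun a _ => ?_
      rw [Finset.sum_comm]
      have : ∀ b, ∑ d, Y a b * (M a c * ((M b d * X d l) * X c k)) =
          Y a b * (M a c * ((if b = l then 1 else 0) * X c k)) := by
        intro b
        rw [← Finset.mul_sum, ← Finset.mul_sum, ← Finset.sum_mul, hr]
      simp only [this]
      simp
    simp only [e2]
    rw [Finset.sum_comm]
    simp [← Finset.mul_sum, hr]
  intro i j k l
  -- both sides are obtained from one another by cancellation
  have hinv : ∀ i j k l, ∑ c, ∑ d, (M i c * M j d) * (X d l * X c k) =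
      if i = k ∧ j = l then 1 else 0 := by
    intro i j k l
    have := cr (fun a b => if i = a ∧ j = b then (1 : R) else 0) k l
    rw [← this]
    refine Finset.sum_congr rfl fun c _ => Finset.sum_congr rfl fun d _ => ?_
    congr 1
    rw [Finset.sum_eq_single i, Finset.sum_eq_single j]
    · simp
    · intro b _ hb; simp [hb.symm]
    · simp
    · intro b _ hb; simp [hb.symm]
    · simp
  set Z := heckeL q (fun i j => X j l * X i k) with hZ
  have key : ∀ a b, ∑ c, ∑ d, (M a c * M b d) * Z c d =
      heckeL q (fun a b => if a = k ∧ b = l then (1 : R) else 0) a b := by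
    intro a b
    rw [hZ, ← heckeL_symm]
    simp only [← h a b]
    simp only [← heckeL_mul_right, ← heckeL_sum, hinv]
  have h1 := cl Z i j
  rw [← h1]
  simp only [key]
  rw [← heckeL_symm]
  rw [Finset.sum_eq_single k, Finset.sum_eq_single l]
  · simp
  · intro b _ hb; simp [hb]
  · simp
  · intro b _ hb; simp [hb]
  · simp

/-- Row and column determinants agree. -/
theorem det_transpose {M : Fin N → Fin N → R} (h : IsQMatrix q M) (hq : q ≠ 0)
    (hs : (∑ w : Equiv.Perm (Fin N), (-q) ^ invLength w * (-q) ^ invLength w) ≠ 0) :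
    qDet q (fun i j => M j i) = qDet q M := by
  have h1 : ∑ w : Equiv.Perm (Fin N), (-q) ^ invLength w • qMinor q M w id =
      (∑ w : Equiv.Perm (Fin N), (-q) ^ invLength w * (-q) ^ invLength w) • qDet q M := by
    rw [Finset.sum_smul]
    refine Finset.sum_congr rfl fun w _ => ?_
    rw [minor_perm h hq, smul_smul]
  have h2 : ∑ w : Equiv.Perm (Fin N), (-q) ^ invLength w • qMinor q M w id =
      (∑ w : Equiv.Perm (Fin N), (-q) ^ invLength w * (-q) ^ invLength w) •
        qDet q (fun i j => M j i) := by
    rw [Finset.sum_smul]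
    have h3 : ∀ w : Equiv.Perm (Fin N), ((-q) ^ invLength w * (-q) ^ invLength w) •
        qDet q (fun i j => M j i) = (-q) ^ invLength w • qMinor q (fun i j => M j i) w id := by
      intro w
      rw [minor_perm h.transpose hq, smul_smul]
    simp only [h3, qMinor, Finset.smul_sum]
    rw [Finset.sum_comm]
    refine Finset.sum_congr rfl fun w _ => Finset.sum_congr rfl fun s _ => ?_
    rw [smul_smul, smul_smul, mul_comm]
    rfl
  exact smul_right_injective _ hs (h2.symm.trans h1)

theorem IsQMatrix.det_mul {M M' : Fin N → Fin N → R} (h' : IsQMatrix q M')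
    (hq : q ≠ 0) (hc : ∀ i j k l, Commute (M i j) (M' k l)) :
    qDet q (fun i j => ∑ k, M i k * M' k j) = qDet q M * qDet q M' := by
  have hy : IsQExt q (fun i => ∑ j, scal R N (M' i j) * fock R q N j) :=
    fock_ext.comb (h'.map (scal R N)) hq (fun i j l => fock_scal l _)
  have h1 := hy.det (c := fun i j => scal R N (M i j)) (by
    intro i j l
    refine Commute.sum_left _ _ _ fun k _ => Commute.mul_left ?_ (fock_scal _ _)
    exact ((hc i j l k).map (scal R N)).symm)
  have h2 : (fun i => ∑ j, scal R N (M i j) * ∑ k, scal R N (M' j k) * fock R q N k) =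
      fun i => ∑ k, scal R N (∑ j, M i j * M' j k) * fock R q N k := by
    funext i
    simp only [Finset.mul_sum, map_sum, map_mul, Finset.sum_mul, mul_assoc]
    exact Finset.sum_comm
  rw [h2] at h1
  have h3 := coeff_det (q := q) (fun i j => ∑ k, M i k * M' k j) id
  simp only [id] at h3
  rw [h1, ← map_qMinor_det, scal_mul] at h3
  have h4 := coeff_det (q := q) M' id
  simp only [id] at h4
  rw [h4] at h3
  exact h3.symm


/-- Reversing both index sets gives a quantum matrix over the opposite algebra. -/
theorem IsQMatrix.op_rev {M : Fin N → Fin N → R} (h : IsQMatrix q M) :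
    IsQMatrix q (fun i j => MulOpposite.op (M i.rev j.rev)) where
  col i j a hij := by
    rw [← MulOpposite.op_mul, ← MulOpposite.op_mul, ← MulOpposite.op_smul,
      h.col j.rev i.rev _ (Fin.rev_lt_rev.2 hij)]
  row i a b hab := by
    rw [← MulOpposite.op_mul, ← MulOpposite.op_mul, ← MulOpposite.op_smul,
      h.row _ b.rev a.rev (Fin.rev_lt_rev.2 hab)]
  comm i j a b hij hab := by
    rw [← MulOpposite.op_mul, ← MulOpposite.op_mul,
      h.comm j.rev i.rev _ _ (Fin.rev_lt_rev.2 hij) (Fin.rev_lt_rev.2 hab)]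
  cross i j a b hij hab := by
    simp only [← MulOpposite.op_mul, ← MulOpposite.op_smul, ← MulOpposite.op_sub]
    rw [h.cross j.rev i.rev _ _ (Fin.rev_lt_rev.2 hij) (Fin.rev_lt_rev.2 hab)]

theorem invLength_conj {k : ℕ} (s : Equiv.Perm (Fin k)) :
    invLength (Fin.revPerm.trans (s.trans Fin.revPerm)) = invLength s := by
  unfold invLength
  refine Finset.card_bij (fun p _ => (p.2.rev, p.1.rev)) ?_ ?_ ?_
  · intro p hp
    simpa [Fin.rev_lt_rev] using hp
  · intro p _ p' _ h
    simp only [Prod.mk.injEq, Fin.rev_inj] at h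
    exact Prod.ext h.2 h.1
  · intro p hp
    exact ⟨(p.2.rev, p.1.rev), by simpa [Fin.rev_lt_rev] using hp, by simp⟩

theorem prod_ofFn_op {k : ℕ} (f : Fin k → R) :
    (List.ofFn fun p => MulOpposite.op (f p)).prod = MulOpposite.op (List.ofFn f).reverse.prod := by
  rw [MulOpposite.op_list_prod, List.map_reverse, List.reverse_reverse, List.map_ofFn]
  rfl

theorem reverse_ofFn_eq {α : Type*} {k : ℕ} (f : Fin k → α) :
    (List.ofFn f).reverse = List.ofFn fun p => f p.rev := by
  refine List.ext_getElem (by simp) ?_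
  intro n h1 h2
  simp only [List.getElem_reverse, List.getElem_ofFn, List.length_ofFn]
  congr 1
  ext
  simp [Fin.rev]
  omega

theorem qMinor_op_rev (M : Fin N → Fin N → R) {k : ℕ} (r c : Fin k → Fin N) :
    qMinor q (fun i j => MulOpposite.op (M i.rev j.rev)) r c =
      MulOpposite.op (qMinor q M (fun p => (r p.rev).rev) (fun p => (c p.rev).rev)) := by
  unfold qMinor
  rw [Finset.op_sum]
  have hinv : ∀ s : Equiv.Perm (Fin k), Fin.revPerm.trans
      ((Fin.revPerm.trans (s.trans Fin.revPerm)).trans Fin.revPerm) = s := by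
    intro s; ext p; simp
  refine Fintype.sum_equiv (ι := Equiv.Perm (Fin k)) (κ := Equiv.Perm (Fin k))
    ⟨fun s : Equiv.Perm (Fin k) => Fin.revPerm.trans (s.trans Fin.revPerm),
    fun s : Equiv.Perm (Fin k) => Fin.revPerm.trans (s.trans Fin.revPerm), hinv, hinv⟩ _ _ fun s => ?_
  rw [prod_ofFn_op, ← MulOpposite.op_smul, reverse_ofFn_eq]
  simp only [Equiv.coe_fn_mk, invLength_conj]
  simp

theorem rev_skip {N : ℕ} (j : Fin N) (p : Fin (N - 1)) : (skip j p.rev).rev = skip j.rev p := by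
  ext
  simp only [skip, Fin.val_rev]
  split_ifs <;> omega

/-- Laplace expansion with the minors on the left. -/
theorem laplace' {M : Fin N → Fin N → R} (hM : IsQMatrix q M) (hq : q ≠ 0) (i j : Fin N) :
    ∑ k : Fin N, ((-q) ^ (k.rev : ℕ) • qMinor q M (skip j) (skip k)) * M i k =
      if i = j then (-q) ^ (j.rev : ℕ) • qDet q M else 0 := by
  have h := laplace hM.op_rev hq i.rev j.rev
  apply MulOpposite.op_injective
  have e : (MulOpposite.op (if i = j then (-q) ^ (j.rev : ℕ) • qDet q M else 0) : Rᵐᵒᵖ) =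
      if i.rev = j.rev then (-q) ^ (j.rev : ℕ) •
        qDet q (fun i j => MulOpposite.op (M i.rev j.rev)) else 0 := by
    simp only [Fin.rev_inj]
    split_ifs
    · rw [qDet, qDet, qMinor_op_rev, MulOpposite.op_smul]
      simp [Function.id_def]
    · rfl
  rw [e, ← h, Finset.op_sum]
  refine Fintype.sum_equiv Fin.revPerm _ _ fun k => ?_
  rw [qMinor_op_rev]
  simp only [rev_skip, Fin.revPerm_apply, Fin.rev_rev, MulOpposite.op_mul, MulOpposite.op_smul]

/-- The quantum cofactor matrix. -/
noncomputable def qCofactor (q : ℂ) (M : Fin N → Fin N → R) (i j : Fin N) : R :=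
  (-q) ^ ((j : ℤ) - (i : ℤ)) • qMinor q M (skip i) (skip j)

theorem cofactor_right {M : Fin N → Fin N → R} (hM : IsQMatrix q M) (hq : q ≠ 0)
    (hd : qDet q M = 1) (i j : Fin N) :
    ∑ k, M i k * qCofactor q M j k = if i = j then 1 else 0 := by
  have hq' : -q ≠ 0 := neg_ne_zero.2 hq
  have h := congrArg (fun z => (-q) ^ (-(j : ℤ)) • z) (laplace hM hq i j)
  simp only [Finset.smul_sum, hd] at h
  have e : (-q) ^ (-(j : ℤ)) • (if i = j then (-q) ^ (j : ℕ) • (1 : R) else 0) =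
      if i = j then 1 else 0 := by
    split_ifs
    · rw [smul_smul, ← zpow_natCast, ← zpow_add₀ hq']; simp
    · simp
  rw [e] at h
  rw [← h]
  refine Finset.sum_congr rfl fun k _ => ?_
  rw [qCofactor, ← mul_smul_comm, smul_smul, ← zpow_natCast, ← zpow_add₀ hq']
  congr 3
  ring

theorem cofactor_left_aux {M : Fin N → Fin N → R} (hM : IsQMatrix q M) (hq : q ≠ 0)
    (hd : qDet q (fun i j => M j i) = 1) (i j : Fin N) :
    ∑ k : Fin N, ((-q) ^ ((k.rev : ℤ) - (j.rev : ℤ)) •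
      qMinor q (fun i j => M j i) (skip j) (skip k)) * M k i = if j = i then 1 else 0 := by
  have hq' : -q ≠ 0 := neg_ne_zero.2 hq
  have h := congrArg (fun z => (-q) ^ (-(j.rev : ℤ)) • z) (laplace' hM.transpose hq i j)
  simp only [Finset.smul_sum, hd] at h
  have e : (-q) ^ (-(j.rev : ℤ)) • (if i = j then (-q) ^ (j.rev : ℕ) • (1 : R) else 0) =
      if j = i then 1 else 0 := by
    simp only [eq_comm (a := i)]
    split_ifs
    · rw [smul_smul, ← zpow_natCast, ← zpow_add₀ hq']; simp
    · simp
  rw [e] at h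
  rw [← h]
  refine Finset.sum_congr rfl fun k _ => ?_
  rw [← smul_mul_assoc, smul_smul, ← zpow_natCast, ← zpow_add₀ hq']
  congr 3
  ring

theorem left_inv_eq_right_inv {U V M : Fin N → Fin N → R}
    (hl : ∀ i j, ∑ k, U i k * M k j = if i = j then 1 else 0)
    (hr : ∀ i j, ∑ k, M i k * V k j = if i = j then 1 else 0) : U = V := by
  have h1 : Matrix.of U * Matrix.of M = 1 := by
    ext i j; simp [Matrix.mul_apply, hl, Matrix.one_apply]
  have h2 : Matrix.of M * Matrix.of V = 1 := by
    ext i j; simp [Matrix.mul_apply, hr, Matrix.one_apply]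
  exact Matrix.of.injective (_root_.left_inv_eq_right_inv h1 h2)

theorem cofactor_left {M : Fin N → Fin N → R} (hM : IsQMatrix q M) (hq : q ≠ 0)
    (hs : (∑ w : Equiv.Perm (Fin N), (-q) ^ invLength w * (-q) ^ invLength w) ≠ 0)
    (hd : qDet q M = 1) (i j : Fin N) :
    ∑ k, qCofactor q M k i * M k j = if i = j then 1 else 0 := by
  have h1 := cofactor_left_aux hM hq ((det_transpose hM hq hs).trans hd)
  have h2 := left_inv_eq_right_inv (V := fun i j => qCofactor q M j i)
    (fun i j => h1 j i) (cofactor_right hM hq hd)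
  have h3 := h1 j i
  rw [← h3]
  refine Finset.sum_congr rfl fun k _ => ?_
  rw [← congrFun (congrFun h2 i) k]

theorem prod_expand_rev {y x : Fin N → R} {c : Fin N → Fin N → R}
    (hx : ∀ k, x k = ∑ j, y j * c j k) (hc : ∀ i j l, Commute (x l) (c i j)) :
    ∀ {k : ℕ} (r : Fin k → Fin N), (List.ofFn fun p => x (r p)).prod =
      ∑ f : Fin k → Fin N, (List.ofFn fun p => y (f p)).prod *
        (List.ofFn fun p => c (f p) (r p)).reverse.prod
  | 0, r => by simp
  | k + 1, r => by
    have hcm : ∀ j, Commute (c j (r 0)) (List.ofFn fun p : Fin k => x (r p.succ)).prod := by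
      intro j
      refine Commute.list_prod_right _ _ ?_
      intro z hz
      obtain ⟨p, rfl⟩ := List.mem_ofFn.1 hz
      exact (hc _ _ _).symm
    rw [List.ofFn_succ, List.prod_cons, hx (r 0), Finset.sum_mul,
      ← (Fin.consEquiv fun _ => Fin N).sum_comp, Fintype.sum_prod_type]
    refine Finset.sum_congr rfl fun j _ => ?_
    rw [mul_assoc, (hcm j).eq, prod_expand_rev hx hc (fun p => r p.succ), Finset.sum_mul,
      Finset.mul_sum]
    refine Finset.sum_congr rfl fun f _ => ?_
    simp only [List.ofFn_succ, List.prod_cons, Fin.consEquiv_apply, Fin.cons_zero, Fin.cons_succ,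
      List.reverse_cons, List.prod_append, List.prod_nil, mul_one, mul_assoc]

/-- The opposite determinant of the inverse of a quantum matrix of determinant one. -/
theorem det_inv {M X : Fin N → Fin N → R} (hM : IsQMatrix q M) (hq : q ≠ 0)
    (hd : qDet q (fun i j => M j i) = 1)
    (hr : ∀ i j, ∑ k, M i k * X k j = if i = j then 1 else 0) :
    ∑ s : Equiv.Perm (Fin N), (-q) ^ invLength s •
      (List.ofFn fun p => X (s p) p).reverse.prod = 1 := by
  have hy : IsQExt q (fun i => ∑ j, scal R N (M j i) * fock R q N j) :=
    fock_ext.comb (hM.transpose.map (scal R N)) hq (fun i j l => fock_scal l _)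
  have hx : ∀ k, fock R q N k =
      ∑ j, (∑ i, scal R N (M i j) * fock R q N i) * scal R N (X j k) := by
    intro k
    have e : ∀ j, (∑ i, scal R N (M i j) * fock R q N i) * scal R N (X j k) =
        ∑ i, scal R N (M i j * X j k) * fock R q N i := by
      intro j
      rw [Finset.sum_mul]
      refine Finset.sum_congr rfl fun i _ => ?_
      rw [mul_assoc, (fock_scal i (X j k)).eq, ← mul_assoc, ← map_mul]
    simp only [e]
    rw [Finset.sum_comm]
    simp only [← Finset.sum_mul, ← map_sum, hr]
    simp
  have h1 := prod_expand_rev (c := fun i j => scal R N (X i j)) hx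
    (fun i j l => fock_scal l _) id
  rw [sum_inj] at h1
  · have h2 : ∀ s : Equiv.Perm (Fin N),
        (List.ofFn fun p => ∑ i, scal R N (M i (s p)) * fock R q N i).prod =
          (-q) ^ invLength s • (List.ofFn fun p => ∑ i, scal R N (M i p) * fock R q N i).prod :=
      fun s => hy.perm id strictMono_id s
    have h3 : ∀ s : Equiv.Perm (Fin N),
        (List.ofFn fun p => scal R N (X (s p) p)).reverse.prod =
          scal R N (List.ofFn fun p => X (s p) p).reverse.prod := by
      intro s
      rw [map_list_prod, List.map_reverse, List.map_ofFn]
      rfl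
    simp only [id, h2, h3, smul_mul_assoc] at h1
    simp only [← mul_smul_comm, ← map_smul, ← Finset.mul_sum, ← map_sum] at h1
    have h4 := congrArg (fun Y : Matrix _ _ R => Y Finset.univ ∅) h1
    simp only [mul_scal] at h4
    have h5 := coeff_det (q := q) (fun i j => M j i) id
    simp only [id] at h5
    rw [h5] at h4
    have h6 := fock_sorted (R := R) (q := q) (List.ofFn (id : Fin N → Fin N))
      (by rw [List.pairwise_ofFn]; exact fun a b h => h) Finset.univ
    rw [List.map_ofFn, if_pos (by ext a; simp [List.mem_ofFn])] at h6
    have h7 : (List.ofFn fun p => fock R q N p).prod Finset.univ ∅ = (1 : R) := h6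
    rw [h7] at h4
    rw [show qMinor q (fun i j => M j i) id id = 1 from hd, one_mul] at h4
    exact h4.symm
  · intro f hf
    rw [hy.not_inj f hf, zero_mul]

theorem IsQMatrix.twist {M : Fin N → Fin N → R} (h : IsQMatrix q M) (a b : Fin N → ℂ) :
    IsQMatrix q (fun i j => (a i * b j) • M i j) where
  col i j k hij := by
    simp only [smul_mul_smul_comm, h.col i j k hij, smul_smul]; congr 1; ring
  row i k l hkl := by
    simp only [smul_mul_smul_comm, h.row i k l hkl, smul_smul]; congr 1; ring
  comm i j k l hij hkl := by
    simp only [smul_mul_smul_comm, h.comm i j k l hij hkl]; congr 1; ring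
  cross i j k l hij hkl := by
    simp only [smul_mul_smul_comm]
    have h1 : M i k * M j l = M j l * M i k + (q - q⁻¹) • (M j k * M i l) := by
      rw [← h.cross i j k l hij hkl]; abel
    rw [h1]
    module

theorem qDet_twist (M : Fin N → Fin N → R) (a b : Fin N → ℂ) :
    qDet q (fun i j => (a i * b j) • M i j) = ((∏ i, a i) * ∏ j, b j) • qDet q M := by
  have key : ∀ {k : ℕ} (c : Fin k → ℂ) (f : Fin k → R),
      (List.ofFn fun p => c p • f p).prod = (∏ p, c p) • (List.ofFn f).prod := by
    intro k c f
    induction k with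
    | zero => simp
    | succ k ih =>
      rw [List.ofFn_succ, List.ofFn_succ, List.prod_cons, List.prod_cons, ih, Fin.prod_univ_succ,
        smul_mul_smul_comm]
  unfold qDet qMinor
  rw [Finset.smul_sum]
  refine Finset.sum_congr rfl fun s _ => ?_
  simp only [id]
  rw [key, smul_smul, smul_smul, Finset.prod_mul_distrib, Equiv.prod_comp s b, mul_comm]


/-- The `q`-determinant of the identity matrix. -/
theorem qDet_one : qDet q (fun i j : Fin N => if i = j then (1 : R) else 0) = 1 := by
  have h := coeff_det (q := q) (fun i j : Fin N => if i = j then (1 : R) else 0) id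
  have e : (fun p : Fin N => ∑ j, scal R N (if p = j then (1 : R) else 0) * fock R q N j) =
      fun p => fock R q N p := by
    funext p
    rw [Finset.sum_eq_single p]
    · simp
    · intro b _ hb; simp [hb.symm]
    · simp
  simp only [id] at h
  rw [e] at h
  have h6 := fock_sorted (R := R) (q := q) (List.ofFn (id : Fin N → Fin N))
    (by rw [List.pairwise_ofFn]; exact fun a b h => h) Finset.univ
  rw [List.map_ofFn, if_pos (by ext a; simp [List.mem_ofFn])] at h6
  exact h.symm.trans h6

theorem isQMatrix_one : IsQMatrix q (fun i j : Fin N => if i = j then (1 : R) else 0) where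
  col i j a hij := by
    have := hij.ne
    by_cases h1 : i = a <;> by_cases h2 : j = a <;> simp [h1, h2]
    exact absurd (h1.trans h2.symm) this
  row i a b hab := by
    have := hab.ne
    have h3 : ¬ (i = a ∧ i = b) := fun h => this (h.1.symm.trans h.2)
    by_cases h1 : i = a <;> by_cases h2 : i = b
    · exact absurd ⟨h1, h2⟩ h3
    all_goals simp only [h1, h2, if_true, if_false, mul_zero, smul_zero]
    all_goals simp [this, this.symm]
  comm i j a b _ _ := by split_ifs <;> simp
  cross i j a b hij hab := by
    by_cases h1 : j = a <;> by_cases h2 : i = b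
    · subst h1; subst h2; exact absurd hij hab.not_gt
    all_goals split_ifs <;> simp_all

theorem prod_ofFn_block {B : Type*} [Ring B] (a : B) : ∀ {N : ℕ} (x y : Fin N → B) (k : ℕ)
    (hk : k + 1 < N), (∀ i, Commute (x i) a) → (∀ i : Fin N, i.1 ≠ k → i.1 ≠ k + 1 → y i = x i) →
    y ⟨k, by omega⟩ * y ⟨k + 1, hk⟩ = a * (x ⟨k, by omega⟩ * x ⟨k + 1, hk⟩) →
    (List.ofFn y).prod = a * (List.ofFn x).prod
  | 0, _, _, k, hk, _, _, _ => by omega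
  | 1, _, _, k, hk, _, _, _ => by omega
  | N + 2, x, y, 0, hk, hc, he, hm => by
    have e : (fun i : Fin N => y i.succ.succ) = fun i => x i.succ.succ := by
      funext i
      exact he _ (by simp) (by simp)
    have hm' : y 0 * y (Fin.succ 0) = a * (x 0 * x (Fin.succ 0)) := hm
    simp only [List.ofFn_succ, List.prod_cons]
    rw [e, ← mul_assoc, hm']
    simp only [mul_assoc]
  | N + 2, x, y, k + 1, hk, hc, he, hm => by
    have h0 : y 0 = x 0 := he 0 (by simp) (by simp)
    have := prod_ofFn_block a (fun i : Fin (N + 1) => x i.succ) (fun i => y i.succ) k (by omega)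
      (fun i => hc _) (fun i h1 h2 => he i.succ (by simpa using h1) (by simpa using h2)) hm
    rw [List.ofFn_succ (f := y), List.prod_cons, List.ofFn_succ (f := x), List.prod_cons, this, h0,
      ← mul_assoc, (hc 0).eq, mul_assoc]

/-- Position `k` among the indices `0, …, N-1`. -/
def lo {N : ℕ} (k : Fin (N - 1)) : Fin N := ⟨k, by omega⟩
/-- Position `k + 1` among the indices `0, …, N-1`. -/
def hi {N : ℕ} (k : Fin (N - 1)) : Fin N := ⟨k + 1, by omega⟩

/-- The matrix that agrees with the `2 × 2` matrix `M` on the rows and columns `k, k+1`, and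
with the identity matrix elsewhere. -/
def blockMatrix (M : Fin 2 → Fin 2 → R) (k : Fin (N - 1)) (i j : Fin N) : R :=
  if (i = lo k ∨ i = hi k) ∧ (j = lo k ∨ j = hi k) then
    M (if i = lo k then 0 else 1) (if j = lo k then 0 else 1)
  else if i = j then 1 else 0

theorem block_isQMatrix {M : Fin 2 → Fin 2 → R} (h : IsQMatrix q M) (k : Fin (N - 1)) :
    IsQMatrix q (blockMatrix M k) := by
  have hlh : (lo k : Fin N) < hi k := by simp [lo, hi, Fin.lt_def]
  have btw : ∀ i : Fin N, lo k < i → i < hi k → False := by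
    intro i; simp only [lo, hi, Fin.lt_def]; omega
  have bll : blockMatrix M k (lo k) (lo k) = M 0 0 := by simp [blockMatrix]
  have blh : blockMatrix M k (lo k) (hi k) = M 0 1 := by simp [blockMatrix, hlh.ne']
  have bhl : blockMatrix M k (hi k) (lo k) = M 1 0 := by simp [blockMatrix, hlh.ne']
  have bhh : blockMatrix M k (hi k) (hi k) = M 1 1 := by simp [blockMatrix, hlh.ne']
  have b1 : ∀ i, i ≠ lo k → i ≠ hi k → blockMatrix M k i i = 1 := by
    intro i h1 h2; simp [blockMatrix, h1, h2]
  have b0 : ∀ i j, i ≠ j → ((i ≠ lo k ∧ i ≠ hi k) ∨ (j ≠ lo k ∧ j ≠ hi k)) →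
      blockMatrix M k i j = 0 := by
    intro i j hij h1
    rw [blockMatrix, if_neg, if_neg hij]
    rintro ⟨h2, h3⟩
    rcases h1 with h1 | h1
    · exact h2.elim h1.1 h1.2
    · exact h3.elim h1.1 h1.2
  generalize hB : blockMatrix M k = B at *
  generalize (lo k : Fin N) = l at *
  generalize (hi k : Fin N) = r at *
  have c01 := h.col 0 1 0 (by decide)
  have c11 := h.col 0 1 1 (by decide)
  have r01 := h.row 0 0 1 (by decide)
  have r11 := h.row 1 0 1 (by decide)
  have hcm := h.comm 0 1 1 0 (by decide) (by decide)
  have hcr := h.cross 0 1 0 1 (by decide) (by decide)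
  constructor
  · intro i j a hij
    by_cases hi : i = l ∨ i = r
    · by_cases hj : j = l ∨ j = r
      · have e1 : i = l := by rcases hi with rfl | rfl <;> rcases hj with rfl | rfl <;> grind
        have e2 : j = r := by grind
        subst e1 e2
        by_cases ha : a = i
        · subst ha; rw [bll, bhl, c01]
        · by_cases ha' : a = j
          · subst ha'; rw [blh, bhh, c11]
          · rw [b0 i a (Ne.symm ha) (Or.inr ⟨ha, ha'⟩)]; simp
      · rcases eq_or_ne j a with rfl | hne
        · rw [b0 i j hij.ne (Or.inr (by grind))]; simp
        · rw [b0 j a hne (Or.inl (by grind))]; simp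
    · rcases eq_or_ne i a with rfl | hne
      · rw [b0 j i hij.ne' (Or.inr (by grind))]; simp
      · rw [b0 i a hne (Or.inl (by grind))]; simp
  · intro i a b hab
    by_cases hi : a = l ∨ a = r
    · by_cases hj : b = l ∨ b = r
      · have e1 : a = l := by rcases hi with rfl | rfl <;> rcases hj with rfl | rfl <;> grind
        have e2 : b = r := by grind
        subst e1 e2
        by_cases ha : i = a
        · subst ha; rw [bll, blh, r01]
        · by_cases ha' : i = b
          · subst ha'; rw [bhl, bhh, r11]
          · rw [b0 i a ha (Or.inl ⟨ha, ha'⟩)]; simp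
      · rcases eq_or_ne i b with rfl | hne
        · rw [b0 i a hab.ne' (Or.inl (by grind))]; simp
        · rw [b0 i b hne (Or.inr (by grind))]; simp
    · rcases eq_or_ne i a with rfl | hne
      · rw [b0 i b hab.ne (Or.inl (by grind))]; simp
      · rw [b0 i a hne (Or.inr (by grind))]; simp
  · intro i j a b hij hab
    by_cases h1 : (i = l ∨ i = r) ∧ (a = l ∨ a = r)
    · by_cases h2 : (j = l ∨ j = r) ∧ (b = l ∨ b = r)
      · have e1 : i = l := by grind
        have e2 : j = r := by grind
        have e3 : b = l := by grind
        have e4 : a = r := by grind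
        rw [e1, e2, e3, e4, blh, bhl, hcm]
      · rcases eq_or_ne j b with rfl | hne
        · rw [b1 j (by grind) (by grind)]; simp
        · rw [b0 j b hne (by grind)]; simp
    · rcases eq_or_ne i a with rfl | hne
      · rw [b1 i (by grind) (by grind)]; simp
      · rw [b0 i a hne (by grind)]; simp
  · intro i j a b hij hab
    by_cases hall : i = l ∧ j = r ∧ a = l ∧ b = r
    · obtain ⟨rfl, rfl, rfl, rfl⟩ := hall
      rw [bll, bhh, bhl, blh, hcr]
    · have z : B j a * B i b = 0 := by
        by_cases hz : (j ≠ a ∧ ((j ≠ l ∧ j ≠ r) ∨ (a ≠ l ∧ a ≠ r)))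
        · rw [b0 j a hz.1 hz.2, zero_mul]
        · by_cases hz' : (i ≠ b ∧ ((i ≠ l ∧ i ≠ r) ∨ (b ≠ l ∧ b ≠ r)))
          · rw [b0 i b hz'.1 hz'.2, mul_zero]
          · exfalso
            have bj := btw j
            have bi := btw i
            have ba := btw a
            have bb := btw b
            grind
      rw [z, smul_zero, sub_eq_zero]
      by_cases h1 : (i = l ∨ i = r) ∧ (a = l ∨ a = r)
      · by_cases h2 : (j = l ∨ j = r) ∧ (b = l ∨ b = r)
        · exfalso; grind
        · rcases eq_or_ne j b with rfl | hne
          · rw [b1 j (by grind) (by grind)]; simp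
          · rw [b0 j b hne (by grind)]; simp
      · rcases eq_or_ne i a with rfl | hne
        · rw [b1 i (by grind) (by grind)]; simp
        · rw [b0 i a hne (by grind)]; simp

theorem qDet_two (M : Fin 2 → Fin 2 → R) : qDet q M = M 0 0 * M 1 1 - q • (M 0 1 * M 1 0) := by
  have h1 : invLength (1 : Equiv.Perm (Fin 2)) = 0 := by decide
  have h2 : invLength (Equiv.swap (0 : Fin 2) 1) = 1 := by decide
  have hu : (Finset.univ : Finset (Equiv.Perm (Fin 2))) = {1, Equiv.swap 0 1} := by decide
  rw [qDet, qMinor, hu, Finset.sum_pair (by decide), h1, h2]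
  simp [sub_eq_add_neg]

theorem block_det (M : Fin 2 → Fin 2 → R) (k : Fin (N - 1)) :
    qDet q (blockMatrix (N := N) M k) = qDet q M := by
  have hlh : (lo k : Fin N) < hi k := by simp [lo, hi, Fin.lt_def]
  have e : ∀ i : Fin N, i.1 ≠ k.1 → i.1 ≠ k.1 + 1 →
      ∑ j, scal R N (blockMatrix M k i j) * fock R q N j = fock R q N i := by
    intro i h1 h2
    have h1' : i ≠ lo k := fun h => h1 (by rw [h]; rfl)
    have h2' : i ≠ hi k := fun h => h2 (by rw [h]; rfl)
    rw [Finset.sum_eq_single i]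
    · simp [blockMatrix, h1', h2']
    · intro b _ hb; simp [blockMatrix, h1', h2', hb.symm]
    · simp
  have two : ∀ i : Fin N, i = lo k ∨ i = hi k →
      ∑ j, scal R N (blockMatrix M k i j) * fock R q N j =
        scal R N (M (if i = lo k then 0 else 1) 0) * fock R q N (lo k) +
        scal R N (M (if i = lo k then 0 else 1) 1) * fock R q N (hi k) := by
    intro i hi'
    rw [← Finset.sum_subset (Finset.subset_univ {lo k, hi k}), Finset.sum_pair hlh.ne]
    · simp only [blockMatrix, hi', true_and, true_or, or_true, if_true, hlh.ne', if_false]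
    · intro j _ hj
      have h3 : j ≠ lo k ∧ j ≠ hi k := by simpa using hj
      have h4 : i ≠ j := by rintro rfl; exact hi'.elim h3.1 h3.2
      simp [blockMatrix, h3, h4]
  have tl := two (lo k) (Or.inl rfl)
  have th := two (hi k) (Or.inr rfl)
  rw [if_pos rfl] at tl
  rw [if_neg hlh.ne'] at th
  have hp := prod_ofFn_block (scal R N (qDet q M)) (fock R q N)
    (fun i => ∑ j, scal R N (blockMatrix M k i j) * fock R q N j) k.1 (by omega)
    (fun i => fock_scal _ _) e (by
      change (∑ j, scal R N (blockMatrix M k (lo k) j) * fock R q N j) *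
        (∑ j, scal R N (blockMatrix M k (hi k) j) * fock R q N j) =
        scal R N (qDet q M) * (fock R q N (lo k) * fock R q N (hi k))
      rw [tl, th]
      have sw : ∀ (a b : R) (i j : Fin N), (scal R N a * fock R q N i) * (scal R N b * fock R q N j) =
          scal R N (a * b) * (fock R q N i * fock R q N j) := by
        intro a b i j
        rw [mul_assoc, ← mul_assoc (fock R q N i), (fock_scal i b).eq, map_mul]
        simp only [mul_assoc]
      rw [add_mul, mul_add, mul_add, sw, sw, sw, sw, fock_ext.sq, fock_ext.sq,
        fock_ext.anti _ _ hlh, qDet_two, map_sub, map_smul, sub_mul]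
      simp [sub_eq_add_neg])
  have h := coeff_det (q := q) (blockMatrix (N := N) M k) id
  simp only [id] at h
  rw [hp, scal_mul] at h
  have h6 := fock_sorted (R := R) (q := q) (List.ofFn (id : Fin N → Fin N))
    (by rw [List.pairwise_ofFn]; exact fun a b h => h) Finset.univ
  rw [List.map_ofFn, if_pos (by ext a; simp [List.mem_ofFn])] at h6
  have h7 : (List.ofFn (fock R q N)).prod Finset.univ ∅ = (1 : R) := h6
  rw [h7, mul_one] at h
  exact h.symm

end

/-! ### The algebra `ℂ[SL_N]_q` -/

/-- The deformation parameter `q ∈ (0, 1)`. -/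
abbrev QParam : Type := Set.Ioo (0 : ℝ) 1

/-- The parameter as a complex number. -/
noncomputable abbrev QParam.toC (q : QParam) : ℂ := ((q : ℝ) : ℂ)

theorem QParam.ne_zero (q : QParam) : q.toC ≠ 0 := by
  have := q.2.1
  simp only [QParam.toC, ne_eq, Complex.ofReal_eq_zero]
  exact this.ne'

theorem QParam.sum_ne_zero (q : QParam) (N : ℕ) :
    (∑ w : Equiv.Perm (Fin N), (-q.toC) ^ invLength w * (-q.toC) ^ invLength w) ≠ 0 := by
  have h0 : (0 : ℝ) < q := q.2.1
  have h : (∑ w : Equiv.Perm (Fin N), (-q.toC) ^ invLength w * (-q.toC) ^ invLength w) =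
      ((∑ w : Equiv.Perm (Fin N), ((q : ℝ) * q) ^ invLength w : ℝ) : ℂ) := by
    push_cast
    refine Finset.sum_congr rfl fun w _ => ?_
    rw [← mul_pow, neg_mul_neg]
  rw [h, Complex.ofReal_ne_zero]
  refine (Finset.sum_pos (fun w _ => by positivity) ⟨1, Finset.mem_univ _⟩).ne'

/-- The free generators. -/
noncomputable def freeGen {N : ℕ} (i j : Fin N) : FreeAlgebra ℂ (Fin N × Fin N) :=
  FreeAlgebra.ι ℂ (i, j)

/-- The defining relations of `ℂ[SL_N]_q`. -/
inductive SLRel (q : QParam) (N : ℕ) :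
    FreeAlgebra ℂ (Fin N × Fin N) → FreeAlgebra ℂ (Fin N × Fin N) → Prop
  | col (i j a : Fin N) (h : i < j) :
      SLRel q N (freeGen i a * freeGen j a) (q.toC • (freeGen j a * freeGen i a))
  | row (i a b : Fin N) (h : a < b) :
      SLRel q N (freeGen i a * freeGen i b) (q.toC • (freeGen i b * freeGen i a))
  | comm (i j a b : Fin N) (h : i < j) (h' : b < a) :
      SLRel q N (freeGen i a * freeGen j b) (freeGen j b * freeGen i a)
  | cross (i j a b : Fin N) (h : i < j) (h' : a < b) :
      SLRel q N (freeGen i a * freeGen j b - freeGen j b * freeGen i a)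
        ((q.toC - q.toC⁻¹) • (freeGen j a * freeGen i b))
  | det : SLRel q N (qDet q.toC freeGen) 1

/-- The algebra `ℂ[SL_N]_q` with generators `t i j` and the relations `SLRel`. -/
def CSL (q : QParam) (N : ℕ) : Type := RingQuot (SLRel q N)

noncomputable instance (q : QParam) (N : ℕ) : Ring (CSL q N) :=
  inferInstanceAs (Ring (RingQuot (SLRel q N)))

noncomputable instance (q : QParam) (N : ℕ) : Algebra ℂ (CSL q N) :=
  inferInstanceAs (Algebra ℂ (RingQuot (SLRel q N)))

namespace CSL
variable {q : QParam} {N : ℕ}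

variable (q N) in
/-- The quotient map from the free algebra. -/
noncomputable def mk : FreeAlgebra ℂ (Fin N × Fin N) →ₐ[ℂ] CSL q N :=
  RingQuot.mkAlgHom ℂ (SLRel q N)

theorem mk_rel {x y : FreeAlgebra ℂ (Fin N × Fin N)} (h : SLRel q N x y) : mk q N x = mk q N y :=
  RingQuot.mkAlgHom_rel ℂ h

theorem mk_surjective : Function.Surjective (mk q N) :=
  RingQuot.mkAlgHom_surjective ℂ (SLRel q N)

/-- The generators of `ℂ[SL_N]_q`. -/
noncomputable def t (i j : Fin N) : CSL q N := mk q N (freeGen i j)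

theorem isQMatrix_t : IsQMatrix q.toC (t (q := q) (N := N)) where
  col i j a h := by
    have e := mk_rel (SLRel.col (q := q) i j a h)
    simp only [map_mul, map_smul] at e
    exact e
  row i a b h := by
    have e := mk_rel (SLRel.row (q := q) i a b h)
    simp only [map_mul, map_smul] at e
    exact e
  comm i j a b h h' := by
    have e := mk_rel (SLRel.comm (q := q) i j a b h h')
    simp only [map_mul] at e
    exact e
  cross i j a b h h' := by
    have e := mk_rel (SLRel.cross (q := q) i j a b h h')
    simp only [map_mul, map_smul, map_sub] at e
    exact e

theorem qDet_t : qDet q.toC (t (q := q) (N := N)) = 1 := by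
  have := mk_rel (SLRel.det (q := q) (N := N))
  rw [map_qMinor_det, map_one] at this
  exact this

/-- The universal property of `ℂ[SL_N]_q`. -/
noncomputable def lift {B : Type*} [Ring B] [Algebra ℂ B] (M : Fin N → Fin N → B)
    (hM : IsQMatrix q.toC M) (hd : qDet q.toC M = 1) : CSL q N →ₐ[ℂ] B :=
  RingQuot.liftAlgHom ℂ ⟨FreeAlgebra.lift ℂ fun p => M p.1 p.2, by
    have e : ∀ i j, (FreeAlgebra.lift ℂ fun p : Fin N × Fin N => M p.1 p.2) (freeGen i j) = M i j := by
      intro i j; simp [freeGen]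
    intro x y h
    cases h with
    | col i j a h => simpa only [map_mul, map_smul, e] using hM.col i j a h
    | row i a b h => simpa only [map_mul, map_smul, e] using hM.row i a b h
    | comm i j a b h h' => simpa only [map_mul, map_smul, e] using hM.comm i j a b h h'
    | cross i j a b h h' =>
      simpa only [map_mul, map_smul, map_sub, e] using hM.cross i j a b h h'
    | det =>
      rw [map_qMinor_det, map_one]
      simpa only [e] using hd⟩

@[simp] theorem lift_t {B : Type*} [Ring B] [Algebra ℂ B] (M : Fin N → Fin N → B)
    (hM : IsQMatrix q.toC M) (hd : qDet q.toC M = 1) (i j : Fin N) :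
    lift M hM hd (t i j) = M i j := by
  rw [lift, t, mk]
  erw [RingQuot.liftAlgHom_mkAlgHom_apply]
  simp [freeGen]

theorem induction {p : CSL q N → Prop} (hc : ∀ c : ℂ, p (algebraMap ℂ _ c))
    (ht : ∀ i j, p (t i j)) (hm : ∀ a b, p a → p b → p (a * b)) (ha : ∀ a b, p a → p b → p (a + b))
    (a : CSL q N) : p a := by
  obtain ⟨a, rfl⟩ := mk_surjective a
  induction a using FreeAlgebra.induction with
  | grade0 c => rw [AlgHom.commutes]; exact hc c
  | grade1 x => exact ht x.1 x.2
  | mul a b h1 h2 => rw [map_mul]; exact hm _ _ h1 h2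
  | add a b h1 h2 => rw [map_add]; exact ha _ _ h1 h2

variable (q N) in
/-- The comultiplication, `Δ (t i j) = ∑ k, t i k ⊗ t k j`. -/
noncomputable def comul : CSL q N →ₐ[ℂ] CSL q N ⊗[ℂ] CSL q N :=
  lift (fun i j => ∑ k, t i k ⊗ₜ[ℂ] t k j)
    (by
      have h := (isQMatrix_t.map (Algebra.TensorProduct.includeLeft (R := ℂ) (S := ℂ)
        (A := CSL q N) (B := CSL q N))).mul (isQMatrix_t.map
          (Algebra.TensorProduct.includeRight (R := ℂ) (A := CSL q N) (B := CSL q N)))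
          q.ne_zero (fun i j k l => by simp [Commute, SemiconjBy])
      simpa using h)
    (by
      have h := IsQMatrix.det_mul (M := fun i j => Algebra.TensorProduct.includeLeft (R := ℂ) (S := ℂ)
        (A := CSL q N) (B := CSL q N) (t i j)) (isQMatrix_t.map
          (Algebra.TensorProduct.includeRight (R := ℂ) (A := CSL q N) (B := CSL q N)))
          q.ne_zero (fun i j k l => by simp [Commute, SemiconjBy])
      rw [← map_qMinor_det, ← map_qMinor_det, qDet_t, map_one, map_one, mul_one] at h
      simpa using h)

variable (q N) in
/-- The counit, `ε (t i j) = δ_{ij}`. -/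
noncomputable def counit : CSL q N →ₐ[ℂ] ℂ :=
  lift (fun i j => if i = j then 1 else 0) isQMatrix_one qDet_one

/-- The homomorphism `ψ_{(k,k+1)}` from `ℂ[SL_N]_q` to `ℂ[SL_2]_q`: the entries with both indices
in `{k, k+1}` go to the generators of `ℂ[SL_2]_q`, the other ones to Kronecker's delta. -/
noncomputable def psi (k : Fin (N - 1)) : CSL q N →ₐ[ℂ] CSL q 2 :=
  lift (blockMatrix t k) (block_isQMatrix isQMatrix_t k) ((block_det t k).trans qDet_t)

end CSL

/-! ### Involution -/

/-- The opposite algebra of `R` with the complex conjugate scalar multiplication; an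
antimultiplicative antilinear map into `R` is a homomorphism of algebras into `ConjOp R`. -/
def ConjOp (R : Type*) : Type _ := Rᵐᵒᵖ

namespace ConjOp
variable {R : Type*} [Ring R] [Algebra ℂ R]

instance : Ring (ConjOp R) := inferInstanceAs (Ring Rᵐᵒᵖ)

instance : Algebra ℂ (ConjOp R) :=
  RingHom.toAlgebra' (S := Rᵐᵒᵖ) ((algebraMap ℂ Rᵐᵒᵖ).comp (starRingEnd ℂ))
    (fun c x => by
      rw [RingHom.comp_apply]
      exact Algebra.commutes (R := ℂ) (A := Rᵐᵒᵖ) (starRingEnd ℂ c) x)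

/-- The identity map to `ConjOp R`. -/
def toOp : R ≃+ ConjOp R := MulOpposite.opAddEquiv

theorem toOp_mul (a b : R) : toOp (a * b) = toOp b * toOp a := rfl
theorem toOp_one : toOp (1 : R) = 1 := rfl

theorem toOp_smul (c : ℂ) (a : R) : toOp ((starRingEnd ℂ c) • a) = c • toOp a := by
  rw [Algebra.smul_def c, Algebra.smul_def]
  change MulOpposite.op (_ * a) = (MulOpposite.op (algebraMap ℂ R (starRingEnd ℂ c)) * MulOpposite.op a)
  rw [← MulOpposite.op_mul, Algebra.commutes]

theorem toOp_symm_smul (c : ℂ) (a : ConjOp R) :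
    toOp.symm (c • a) = (starRingEnd ℂ c) • toOp.symm a := by
  apply toOp.injective
  rw [toOp_smul]; simp

theorem toOp_real_smul (q : ℂ) (hq : starRingEnd ℂ q = q) (a : R) : toOp (q • a) = q • toOp a := by
  conv_lhs => rw [← hq]
  exact toOp_smul q a

theorem prod_toOp {k : ℕ} (f : Fin k → R) :
    (List.ofFn fun p => toOp (f p)).prod = toOp (List.ofFn f).reverse.prod :=
  prod_ofFn_op f

theorem heckeL_toOp {N : ℕ} {q : ℂ} (hq : starRingEnd ℂ q = q) (Y : Fin N → Fin N → R) (i j) :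
    heckeL q (fun i j => toOp (Y i j)) i j = toOp (heckeL q Y i j) := by
  have h2 : starRingEnd ℂ (q - q⁻¹) = q - q⁻¹ := by simp [hq]
  simp only [heckeL]
  split_ifs
  · rw [toOp_real_smul q hq]
  · rw [map_add, toOp_real_smul _ h2]
  · rfl

theorem isQMatrix_toOp {N : ℕ} {q : ℂ} (hq : starRingEnd ℂ q = q) (hq0 : q ≠ 0)
    (hs : (∑ w : Equiv.Perm (Fin N), (-q) ^ invLength w * (-q) ^ invLength w) ≠ 0)
    {M : Fin N → Fin N → R} (hM : IsQMatrix q M) (hd : qDet q M = 1) :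
    IsQMatrix q (fun i j => toOp (qCofactor q M i j)) := by
  rw [hecke_iff hq0]
  intro i j k l
  have h := hecke_inv (X := fun i j => qCofactor q M j i) hM hq0 (cofactor_left hM hq0 hs hd)
    (cofactor_right hM hq0 hd) k l i j
  simp only [← toOp_mul]
  rw [heckeL_toOp hq (fun i j => qCofactor q M j l * qCofactor q M i k),
    heckeL_toOp hq (fun k l => qCofactor q M j l * qCofactor q M i k)]
  exact congrArg toOp h.symm

theorem qDet_toOp {N : ℕ} {q : ℂ} (hq : starRingEnd ℂ q = q) (hq0 : q ≠ 0)
    (hs : (∑ w : Equiv.Perm (Fin N), (-q) ^ invLength w * (-q) ^ invLength w) ≠ 0)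
    {M : Fin N → Fin N → R} (hM : IsQMatrix q M) (hd : qDet q M = 1) :
    qDet q (fun i j => toOp (qCofactor q M i j)) = 1 := by
  have h := det_inv (X := fun i j => qCofactor q M j i) hM hq0 ((det_transpose hM hq0 hs).trans hd)
    (cofactor_right hM hq0 hd)
  rw [← toOp_one, ← h, map_sum, qDet, qMinor]
  refine Finset.sum_congr rfl fun s _ => ?_
  rw [toOp_real_smul _ (by simp [hq]), ← prod_toOp]
  rfl

end ConjOp

/-- The `*`-algebra `ℂ[G̃]_q`: the algebra `ℂ[SL_{m+n}]_q` with the involution given by the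
instance below. -/
def CG (q : QParam) (m n : ℕ) : Type := CSL q (m + n)

namespace CG
variable (q : QParam) (m n : ℕ)

noncomputable instance : Ring (CG q m n) := inferInstanceAs (Ring (CSL q (m + n)))
noncomputable instance : Algebra ℂ (CG q m n) := inferInstanceAs (Algebra ℂ (CSL q (m + n)))

variable {q m n}

/-- The generators. -/
noncomputable def t (i j : Fin (m + n)) : CG q m n := CSL.t i j

theorem isQMatrix_t : IsQMatrix q.toC (t : _ → _ → CG q m n) := CSL.isQMatrix_t

theorem qDet_t : qDet q.toC (t : _ → _ → CG q m n) = 1 := CSL.qDet_t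

theorem induction {p : CG q m n → Prop} (hc : ∀ c : ℂ, p (algebraMap ℂ _ c))
    (ht : ∀ i j, p (t i j)) (hm : ∀ a b, p a → p b → p (a * b)) (ha : ∀ a b, p a → p b → p (a + b))
    (a : CG q m n) : p a := CSL.induction hc ht hm ha a

/-- The sign of `i - m - 1/2`, where `i` is counted from `1`. -/
def sgnRow (m n : ℕ) (i : Fin (m + n)) : ℂ := if i.1 < m then -1 else 1

/-- The sign of `n - j + 1/2`, where `j` is counted from `1`. -/
def sgnCol (m n : ℕ) (j : Fin (m + n)) : ℂ := if j.1 < n then 1 else -1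

/-- The value of the involution on the generators:
`sign ((i - m - 1/2) (n - j + 1/2)) (-q)^(j-i)` times the minor without row `i` and column `j`. -/
noncomputable def starGen (i j : Fin (m + n)) : CG q m n :=
  (sgnRow m n i * sgnCol m n j) • ((-q.toC) ^ ((j : ℤ) - (i : ℤ)) • qMinor q.toC t (skip i) (skip j))

theorem starGen_eq (i j : Fin (m + n)) : (starGen i j : CG q m n) =
    (sgnRow m n i * sgnCol m n j) • qCofactor q.toC t i j := rfl

theorem conj_sgn (i j : Fin (m + n)) : starRingEnd ℂ (sgnRow m n i * sgnCol m n j) =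
    sgnRow m n i * sgnCol m n j := by
  unfold sgnRow sgnCol; split_ifs <;> simp

theorem prod_sgn : (∏ i, sgnRow m n i) * ∏ j, sgnCol m n j = 1 := by
  have h1 : ∏ i, sgnRow m n i = (-1) ^ m := by
    rw [Fin.prod_univ_add]
    simp [sgnRow]
  have h2 : ∏ j, sgnCol m n j = (-1) ^ m := by
    have e : m + n = n + m := Nat.add_comm m n
    have : ∏ j, sgnCol m n j = ∏ j : Fin (n + m), (if j.1 < n then (1 : ℂ) else -1) :=
      Fintype.prod_equiv (finCongr e) _ _ fun j => by simp [sgnCol]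
    rw [this, Fin.prod_univ_add]
    simp
  rw [h1, h2, ← mul_pow]; simp

/-- The involution as a homomorphism to the conjugate opposite algebra. -/
noncomputable def starHom (q : QParam) (m n : ℕ) : CSL q (m + n) →ₐ[ℂ] ConjOp (CG q m n) :=
  CSL.lift (fun i j => ConjOp.toOp (starGen i j))
    (by
      have h := (ConjOp.isQMatrix_toOp (R := CG q m n) (by simp) q.ne_zero (q.sum_ne_zero _)
        isQMatrix_t qDet_t).twist (sgnRow m n) (sgnCol m n)
      have e : (fun i j => ConjOp.toOp (starGen i j : CG q m n)) = fun i j =>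
          (sgnRow m n i * sgnCol m n j) • ConjOp.toOp (qCofactor q.toC (t : _ → _ → CG q m n) i j) := by
        funext i j
        rw [starGen_eq, ConjOp.toOp_real_smul _ (conj_sgn i j)]
      rw [e]
      exact h)
    (by
      have h := ConjOp.qDet_toOp (R := CG q m n) (by simp) q.ne_zero (q.sum_ne_zero _)
        isQMatrix_t qDet_t
      have e : (fun i j => ConjOp.toOp (starGen i j : CG q m n)) = fun i j =>
          (sgnRow m n i * sgnCol m n j) • ConjOp.toOp (qCofactor q.toC (t : _ → _ → CG q m n) i j) := by
        funext i j
        rw [starGen_eq, ConjOp.toOp_real_smul _ (conj_sgn i j)]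
      rw [e, qDet_twist, prod_sgn, one_smul]
      exact h)

noncomputable instance : Star (CG q m n) := ⟨fun a => ConjOp.toOp.symm (starHom q m n a)⟩

theorem star_def (a : CG q m n) : star a = ConjOp.toOp.symm (starHom q m n a) := rfl

theorem star_t (i j : Fin (m + n)) : star (t i j : CG q m n) = starGen i j := by
  have h : starHom q m n (t i j) = ConjOp.toOp (starGen i j) := CSL.lift_t _ _ _ i j
  rw [star_def, h, AddEquiv.symm_apply_apply]

theorem star_mul' (a b : CG q m n) : star (a * b) = star b * star a := by
  exact congrArg ConjOp.toOp.symm (map_mul (starHom q m n) a b)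

theorem star_add' (a b : CG q m n) : star (a + b) = star a + star b := by
  exact (congrArg ConjOp.toOp.symm (map_add (starHom q m n) a b)).trans (map_add _ _ _)

theorem star_smul' (c : ℂ) (a : CG q m n) : star (c • a) = star c • star a := by
  exact (congrArg ConjOp.toOp.symm (map_smul (starHom q m n) c a)).trans
    (ConjOp.toOp_symm_smul _ _)

theorem star_one' : star (1 : CG q m n) = 1 := by
  exact congrArg ConjOp.toOp.symm (map_one (starHom q m n))

theorem star_sum' {ι : Type*} (s : Finset ι) (f : ι → CG q m n) :
    star (∑ i ∈ s, f i) = ∑ i ∈ s, star (f i) :=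
  map_sum (AddMonoidHom.mk' (star : CG q m n → CG q m n) star_add') f s

theorem sgn_mul (i j : Fin (m + n)) :
    (sgnRow m n i * sgnCol m n j) * (sgnRow m n i * sgnCol m n j) = 1 := by
  unfold sgnRow sgnCol; split_ifs <;> norm_num

theorem star_star_t (i j : Fin (m + n)) : star (star (t i j : CG q m n)) = t i j := by
  have hr := cofactor_right (isQMatrix_t (q := q) (m := m) (n := n)) q.ne_zero qDet_t
  have hX : ∀ i j, qCofactor q.toC (t : _ → _ → CG q m n) i j =
      (sgnRow m n i * sgnCol m n j) • star (t i j) := by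
    intro i j
    rw [star_t, starGen_eq, smul_smul, sgn_mul, one_smul]
  have hl : ∀ i j, ∑ k, star (star (t i k : CG q m n)) *
      qCofactor q.toC (t : _ → _ → CG q m n) j k = if i = j then 1 else 0 := by
    intro i j
    have h := congrArg (fun z => (sgnRow m n i * sgnRow m n j) • star z) (hr j i)
    have e : (sgnRow m n i * sgnRow m n j) • star (if j = i then (1 : CG q m n) else 0) =
        if i = j then 1 else 0 := by
      by_cases hij : i = j
      · subst hij
        have : sgnRow m n i * sgnRow m n i = 1 := by unfold sgnRow; split_ifs <;> norm_num
        simp only [if_true, star_one', this, one_smul]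
      · rw [if_neg hij, if_neg (Ne.symm hij)]
        have : star (0 : CG q m n) = 0 := by
          have := star_smul' (0 : ℂ) (0 : CG q m n)
          simpa using this
        rw [this, smul_zero]
    refine Eq.trans ?_ (h.trans e)
    rw [star_sum', Finset.smul_sum]
    refine Finset.sum_congr rfl fun k _ => ?_
    rw [star_mul', hX i k, star_smul']
    have hc : star (sgnRow m n i * sgnCol m n k) = sgnRow m n i * sgnCol m n k := conj_sgn i k
    rw [hc, hX j k, smul_mul_assoc, mul_smul_comm, smul_smul]
    congr 1
    unfold sgnRow sgnCol; split_ifs <;> simp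
  have hl' := cofactor_left (R := CG q m n) isQMatrix_t q.ne_zero (q.sum_ne_zero _) qDet_t
  have h := left_inv_eq_right_inv (U := fun i k => star (star (t i k : CG q m n)))
    (M := fun i j => qCofactor q.toC (t : _ → _ → CG q m n) j i) hl hl'
  exact congrFun (congrFun h i) j

theorem star_algebraMap' (c : ℂ) : star (algebraMap ℂ (CG q m n) c) = algebraMap ℂ _ (star c) := by
  rw [Algebra.algebraMap_eq_smul_one, star_smul', star_one', Algebra.algebraMap_eq_smul_one]

noncomputable instance : StarRing (CG q m n) where
  star_involutive a := by
    refine induction (p := fun a => star (star a) = a) ?_ star_star_t ?_ ?_ a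
    · intro c
      rw [star_algebraMap', star_algebraMap', star_star]
    · intro a b ha hb
      rw [star_mul', star_mul', ha, hb]
    · intro a b ha hb
      rw [star_add', star_add', ha, hb]
  star_mul := star_mul'
  star_add := star_add'

instance : StarModule ℂ (CG q m n) := ⟨star_smul'⟩

end CG

/-! ### The representation `π_+` -/

/-- The vector space `𝓛_+` with basis `e j`, `j = 0, 1, 2, …`. -/
def Lplus (_ : QParam) : Type := ℕ →₀ ℂ

namespace Lplus
variable {q : QParam}

noncomputable instance : AddCommGroup (Lplus q) := inferInstanceAs (AddCommGroup (ℕ →₀ ℂ))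
noncomputable instance : Module ℂ (Lplus q) := inferInstanceAs (Module ℂ (ℕ →₀ ℂ))

variable (q) in
/-- The standard basis of `𝓛_+`. -/
noncomputable def basis : Module.Basis ℕ ℂ (Lplus q) := Module.Basis.ofRepr (LinearEquiv.refl ℂ (ℕ →₀ ℂ))

variable (q) in
/-- The basis vectors. -/
noncomputable def e (j : ℕ) : Lplus q := basis q j

variable (q) in
/-- The squared norm of `e j`, i.e. `(q^{-2} - 1) (q^{-4} - 1) ⋯ (q^{-2j} - 1)`. -/
noncomputable def weight (j : ℕ) : ℝ := ∏ i ∈ Finset.range j, (((q : ℝ) ^ (2 * (i + 1)))⁻¹ - 1)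

theorem weight_pos (j : ℕ) : 0 < weight q j := by
  refine Finset.prod_pos fun i _ => ?_
  have h0 : (0 : ℝ) < q := q.2.1
  have h1 : (q : ℝ) < 1 := q.2.2
  have h2 : (q : ℝ) ^ (2 * (i + 1)) < 1 := pow_lt_one₀ h0.le h1 (by omega)
  have h3 : 1 < ((q : ℝ) ^ (2 * (i + 1)))⁻¹ := (one_lt_inv₀ (by positivity)).2 h2
  linarith

/-- The pre-Hilbert structure: the vectors `e j` are orthogonal with squared norms `weight q j`. -/
@[reducible] noncomputable def core : InnerProductSpace.Core ℂ (Lplus q) where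
  inner f g := (basis q).repr g |>.sum fun j c => star ((basis q).repr f j) * c * weight q j
  conj_inner_symm f g := by
    rw [Finsupp.sum_of_support_subset (s := ((basis q).repr f).support ∪ ((basis q).repr g).support)
      _ Finset.subset_union_left _ (by simp), Finsupp.sum_of_support_subset
      (s := ((basis q).repr f).support ∪ ((basis q).repr g).support) _ Finset.subset_union_right _
      (by simp), map_sum]
    refine Finset.sum_congr rfl fun j _ => ?_
    simp [mul_comm]
  re_inner_nonneg f := by
    rw [Finsupp.sum, map_sum]
    refine Finset.sum_nonneg fun j _ => ?_
    have h : star ((basis q).repr f j) * (basis q).repr f j * (weight q j : ℂ) =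
        ((Complex.normSq ((basis q).repr f j) * weight q j : ℝ) : ℂ) := by
      rw [Complex.ofReal_mul, Complex.normSq_eq_conj_mul_self]; rfl
    rw [h]
    exact mul_nonneg (Complex.normSq_nonneg _) (weight_pos j).le
  add_left f g h := by
    simp only [map_add, Finsupp.add_apply, star_add, add_mul]
    exact Finsupp.sum_add
  smul_left f g c := by
    simp only [map_smul, Finsupp.smul_apply, Finsupp.sum, Finset.mul_sum, smul_eq_mul, star_mul']
    refine Finset.sum_congr rfl fun j _ => ?_
    simp only [mul_assoc]
    rfl
  definite f hf := by
    have h : ∀ j, star ((basis q).repr f j) * (basis q).repr f j * (weight q j : ℂ) =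
        ((Complex.normSq ((basis q).repr f j) * weight q j : ℝ) : ℂ) := by
      intro j
      rw [Complex.ofReal_mul, Complex.normSq_eq_conj_mul_self]; rfl
    change ((basis q).repr f).sum (fun j c => star ((basis q).repr f j) * c * weight q j) = 0 at hf
    rw [Finsupp.sum] at hf
    simp only [h] at hf
    rw [← Complex.ofReal_sum, Complex.ofReal_eq_zero, Finset.sum_eq_zero_iff_of_nonneg
      (fun j _ => mul_nonneg (Complex.normSq_nonneg _) (weight_pos j).le)] at hf
    apply (basis q).repr.injective
    rw [map_zero]
    ext j
    by_contra hj
    have hj' : (basis q).repr f j ≠ 0 := hj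
    have := hf j (Finsupp.mem_support_iff.2 hj')
    rcases mul_eq_zero.1 this with h1 | h1
    · exact hj' (Complex.normSq_eq_zero.1 h1)
    · exact (weight_pos j).ne' h1

noncomputable instance : NormedAddCommGroup (Lplus q) := core.toNormedAddCommGroup
noncomputable instance : InnerProductSpace ℂ (Lplus q) := InnerProductSpace.ofCore core.toCore

theorem inner_e (i j : ℕ) : inner ℂ (e q i) (e q j) = if i = j then (weight q j : ℂ) else 0 := by
  change ((basis q).repr (e q j)).sum (fun k c => star ((basis q).repr (e q i) k) * c * weight q k) = _
  rw [e, e, Module.Basis.repr_self, Module.Basis.repr_self, Finsupp.sum_single_index (by simp)]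
  by_cases h : i = j
  · simp [h]
  · simp [h]

variable (q) in
/-- The operators `π_+(t_{ij})` on `𝓛_+`. -/
noncomputable def piGen : Fin 2 → Fin 2 → Module.End ℂ (Lplus q) :=
  ![![(basis q).constr ℂ fun j => e q (j + 1),
      (basis q).constr ℂ fun j => (q.toC ^ j)⁻¹ • e q j],
    ![(basis q).constr ℂ fun j => (-(q.toC ^ (j + 1))⁻¹) • e q j,
      (basis q).constr ℂ fun j =>
        if j = 0 then 0 else (1 - (q.toC ^ (2 * j))⁻¹) • e q (j - 1)]]

theorem piGen_00 (j : ℕ) : piGen q 0 0 (e q j) = e q (j + 1) := by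
  simp only [piGen, Matrix.cons_val_zero]
  exact Module.Basis.constr_basis _ _ _ _

theorem piGen_01 (j : ℕ) : piGen q 0 1 (e q j) = (q.toC ^ j)⁻¹ • e q j := by
  simp only [piGen, Matrix.cons_val_zero, Matrix.cons_val_one]
  exact Module.Basis.constr_basis _ _ _ _

theorem piGen_10 (j : ℕ) : piGen q 1 0 (e q j) = (-(q.toC ^ (j + 1))⁻¹) • e q j := by
  simp only [piGen, Matrix.cons_val_zero, Matrix.cons_val_one]
  exact Module.Basis.constr_basis _ _ _ _

theorem piGen_11 (j : ℕ) : piGen q 1 1 (e q j) =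
    if j = 0 then 0 else (1 - (q.toC ^ (2 * j))⁻¹) • e q (j - 1) := by
  simp only [piGen, Matrix.cons_val_one]
  exact Module.Basis.constr_basis _ _ _ _

theorem end_ext {f g : Module.End ℂ (Lplus q)} (h : ∀ j, f (e q j) = g (e q j)) : f = g :=
  (basis q).ext h

theorem piGen_isQMatrix : IsQMatrix q.toC (piGen q) := by
  have hq := q.ne_zero
  have fin : ∀ {P : Fin 2 → Fin 2 → Prop}, P 0 1 → ∀ i j, i < j → P i j := by
    intro P h i j hij
    have hi : i = 0 := by omega
    have hj : j = 1 := by omega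
    rw [hi, hj]; exact h
  have h12 : ∀ j : ℕ, piGen q 1 1 (e q (j + 1)) =
      (1 - (q.toC ^ (2 * (j + 1)))⁻¹) • e q j := by
    intro j; rw [piGen_11, if_neg (by omega)]; rfl
  have h10 : piGen q 1 1 (e q 0) = 0 := by rw [piGen_11, if_pos rfl]
  constructor
  · intro i j a hij
    revert a
    refine fin (P := fun i j => ∀ a, piGen q i a * piGen q j a =
      q.toC • (piGen q j a * piGen q i a)) ?_ i j hij
    intro a
    refine end_ext fun k => ?_
    simp only [Module.End.mul_apply, LinearMap.smul_apply]
    fin_cases a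
    · simp only [Fin.zero_eta, piGen_00, piGen_10, map_smul, smul_smul]
      congr 1; field_simp; try ring
    · simp only [Fin.mk_one, piGen_01, map_smul, smul_smul]
      cases k with
      | zero => simp [h10]
      | succ k =>
        rw [h12]
        simp only [map_smul, piGen_01, smul_smul]
        congr 1; field_simp; try ring
  · intro i a b hab
    revert i
    refine fin (P := fun a b => ∀ i, piGen q i a * piGen q i b =
      q.toC • (piGen q i b * piGen q i a)) ?_ a b hab
    intro i
    refine end_ext fun k => ?_
    simp only [Module.End.mul_apply, LinearMap.smul_apply]
    fin_cases i
    · simp only [Fin.zero_eta, piGen_00, piGen_01, map_smul, smul_smul]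
      congr 1; field_simp; try ring
    · simp only [Fin.mk_one, piGen_10, map_smul, smul_smul]
      cases k with
      | zero => simp [h10]
      | succ k =>
        rw [h12]
        simp only [map_smul, piGen_10, smul_smul]
        congr 1; field_simp; try ring
  · intro i j a b hij hab
    refine fin (P := fun i j => piGen q i a * piGen q j b = piGen q j b * piGen q i a) ?_ i j hij
    refine fin (P := fun b a => piGen q 0 a * piGen q 1 b = piGen q 1 b * piGen q 0 a) ?_ b a hab
    refine end_ext fun k => ?_
    simp only [Module.End.mul_apply, piGen_01, piGen_10, map_smul, smul_smul]
    congr 1; ring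
  · intro i j a b hij hab
    refine fin (P := fun i j => piGen q i a * piGen q j b - piGen q j b * piGen q i a =
      (q.toC - q.toC⁻¹) • (piGen q j a * piGen q i b)) ?_ i j hij
    refine fin (P := fun a b => piGen q 0 a * piGen q 1 b - piGen q 1 b * piGen q 0 a =
      (q.toC - q.toC⁻¹) • (piGen q 1 a * piGen q 0 b)) ?_ a b hab
    refine end_ext fun k => ?_
    simp only [Module.End.mul_apply, LinearMap.smul_apply, LinearMap.sub_apply, piGen_00, piGen_01,
      map_smul, piGen_10, h12, smul_smul]
    cases k with
    | zero =>
      simp only [h10, map_zero, zero_sub, ← neg_smul]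
      congr 1; field_simp; ring
    | succ k =>
      simp only [h12, map_smul, piGen_00, ← sub_smul]
      congr 1; field_simp; ring

theorem piGen_qDet : qDet q.toC (piGen q) = 1 := by
  have hq := q.ne_zero
  rw [qDet_two]
  refine end_ext fun k => ?_
  simp only [LinearMap.sub_apply, LinearMap.smul_apply, Module.End.mul_apply, piGen_10, map_smul,
    piGen_01, smul_smul, Module.End.one_apply, piGen_11]
  cases k with
  | zero =>
    simp [hq]
  | succ k =>
    rw [if_neg (by omega), map_smul, Nat.add_sub_cancel, piGen_00, ← sub_smul]
    nth_rewrite 2 [← one_smul ℂ (e q (k + 1))]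
    congr 1; field_simp; ring

variable (q) in
/-- The representation `π_+` of `ℂ[SL_2]_q` in `𝓛_+`. -/
noncomputable def piPlus : CSL q 2 →ₐ[ℂ] Module.End ℂ (Lplus q) :=
  CSL.lift (piGen q) piGen_isQMatrix piGen_qDet

end Lplus

/-! ### Tensor products of representations -/

/-- A pre-Hilbert space. -/
structure PreHilbert where
  /-- The underlying vector space. -/
  carrier : Type
  [normedGroup : NormedAddCommGroup carrier]
  [innerSpace : InnerProductSpace ℂ carrier]

attribute [instance] PreHilbert.normedGroup PreHilbert.innerSpace

/-- The pre-Hilbert space `H ⊗ (H ⊗ (⋯ ⊗ ℂ))` with `r` factors `H`. -/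
noncomputable def PreHilbert.tensorPower (H : PreHilbert) : ℕ → PreHilbert
  | 0 => ⟨ℂ⟩
  | r + 1 => ⟨H.carrier ⊗[ℂ] (H.tensorPower r).carrier⟩

/-- The pre-Hilbert space `𝓛_+^{⊗ r}`. -/
noncomputable abbrev LplusPow (q : QParam) (r : ℕ) : Type :=
  ((PreHilbert.mk (Lplus q)).tensorPower r).carrier

/-- The vector `e_{k_1} ⊗ ⋯ ⊗ e_{k_r}`. -/
noncomputable def eTensor (q : QParam) : (r : ℕ) → (Fin r → ℕ) → LplusPow q r
  | 0, _ => (1 : ℂ)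
  | r + 1, k => Lplus.e q (k 0) ⊗ₜ[ℂ] eTensor q r (Fin.tail k)

/-- The tensor product of two representations of `ℂ[SL_N]_q`, formed by means of the
comultiplication. -/
noncomputable def tensorRep {q : QParam} {N : ℕ} {V W : Type*} [AddCommGroup V] [Module ℂ V]
    [AddCommGroup W] [Module ℂ W] (π : CSL q N →ₐ[ℂ] Module.End ℂ V)
    (ρ : CSL q N →ₐ[ℂ] Module.End ℂ W) : CSL q N →ₐ[ℂ] Module.End ℂ (V ⊗[ℂ] W) :=
  (Module.endTensorEndAlgHom (R := ℂ) (S := ℂ) (A := ℂ) (M := V) (N := W)).comp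
    ((Algebra.TensorProduct.map π ρ).comp (CSL.comul q N))

/-- The trivial representation `ε` in `ℂ`. -/
noncomputable def trivialRep (q : QParam) (N : ℕ) : CSL q N →ₐ[ℂ] Module.End ℂ ℂ :=
  (Algebra.ofId ℂ (Module.End ℂ ℂ)).comp (CSL.counit q N)

/-- The tensor product of the representations `π_+ ∘ ψ_{σ 0}`, …, `π_+ ∘ ψ_{σ (r-1)}`
of `ℂ[SL_N]_q` in `𝓛_+^{⊗ r}`; the index `k` stands for the transposition of the (zero-based)
positions `k` and `k + 1`. -/
noncomputable def wordRep (q : QParam) (N : ℕ) : (r : ℕ) → (Fin r → Fin (N - 1)) →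
    (CSL q N →ₐ[ℂ] Module.End ℂ (LplusPow q r))
  | 0, _ => trivialRep q N
  | r + 1, σ => tensorRep ((Lplus.piPlus q).comp (CSL.psi (σ 0))) (wordRep q N r (Fin.tail σ))

/-! ### The representation -/

/-- The permutation `u`: in one-based notation `j ↦ m + j` for `j ≤ n` and `j ↦ j - n` for
`j > n`. -/
def uPerm (m n : ℕ) : Equiv.Perm (Fin (m + n)) where
  toFun j := if h : j.1 < n then ⟨m + j, by omega⟩ else ⟨j - n, by omega⟩
  invFun j := if h : j.1 < m then ⟨n + j, by omega⟩ else ⟨j - m, by omega⟩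
  left_inv j := by
    ext
    by_cases h : j.1 < n
    · simp [h]
    · have : j.1 - n < m := by omega
      simp only [h, dite_false, this, dite_true]; omega
  right_inv j := by
    ext
    by_cases h : j.1 < m
    · simp [h]
    · have : j.1 - m < n := by omega
      simp only [h, dite_false, this, dite_true]; omega

/-- The word `σ_1 σ_2 ⋯ σ_{mn}`: the concatenation of the words
`s_i = (i, i+1) (i+1, i+2) ⋯ (i+n-1, i+n)` for `i = m, m-1, …, 1`. The letter number `p`
(from `0`) belongs to `s_i` with `i = m - p / n`, and is its letter number `p % n` (from `0`). -/
def uWord (m n : ℕ) (p : Fin (m * n)) : Fin (m + n - 1) :=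
  ⟨m - 1 - p / n + p % n, by
    have hn : 0 < n := Nat.pos_of_ne_zero (by rintro rfl; exact absurd p.2 (by simp))
    have h1 := Nat.mod_lt p.1 hn
    have h2 : 0 < m := Nat.pos_of_ne_zero (by rintro rfl; exact absurd p.2 (by simp))
    generalize p.1 / n = d at *
    generalize p.1 % n = c at *
    omega⟩

/-- The transposition of the neighbouring positions `k` and `k + 1`. -/
def adjSwap {N : ℕ} (k : Fin (N - 1)) : Equiv.Perm (Fin N) := Equiv.swap (lo k) (hi k)

/-- The representation `T̃` of `ℂ[G̃]_q` in `𝓛_+^{⊗ mn}`. -/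
noncomputable def repT (q : QParam) (m n : ℕ) :
    CG q m n →ₐ[ℂ] Module.End ℂ (LplusPow q (m * n)) :=
  wordRep q (m + n) (m * n) (uWord m n)

/-- The element `t`: the minor with the first `m` rows and the last `m` columns. -/
noncomputable def tMinor (q : QParam) (m n : ℕ) : CG q m n :=
  qMinor q.toC CG.t (fun p : Fin m => ⟨p, by omega⟩) (fun p : Fin m => ⟨n + p, by omega⟩)

/-- The element `x = t t^*`. -/
noncomputable def xElem (q : QParam) (m n : ℕ) : CG q m n := tMinor q m n * star (tMinor q m n)

/-- A representation of a `*`-algebra in a pre-Hilbert space is a `*`-representation if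
`(π(f) v, w) = (v, π(f^*) w)`. -/
def IsStarRep {A V : Type*} [Ring A] [StarRing A] [Algebra ℂ A] [NormedAddCommGroup V]
    [InnerProductSpace ℂ V] (π : A →ₐ[ℂ] Module.End ℂ V) : Prop :=
  ∀ (f : A) (v w : V), inner ℂ (π f v) w = inner ℂ v (π (star f) w)

end QGroup

/-!
Write `P s` for the inverse of the product of the first `s` letters of the word of `u`, so that
`P s x` is the position of the item `x` after `s` letters. Each letter `(k, k+1)` of the word moves
one of the items `0, …, m-1` from `k` to `k + 1`, past one of the other items (`isSweep_uWord`).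
This one combinatorial fact, called a sweep (`IsSweep`), carries all parts of the theorem.

*The `*`-representation.* For families of signs `a`, `b` call a representation `π` signed of type
`(a, b)` if the adjoint of `π (t i j)` is `a i * b j` times `π` of the cofactor of `t i j`
(`IsSignedStarRep`). Since the comultiplication takes cofactors to sums of tensor products of
cofactors (`CSL.comul_cofactor`, by uniqueness of the inverse of a matrix), the tensor product of
representations of types `(a, b)` and `(b, c)` is of type `(a, c)`, as the signs `b k` square to
one. In `𝓛_+` the diagonal generators have the adjoints opposite to those in the compact form, so
that `π_+ ∘ ψ_{(k,k+1)}` moves a sign `-1` from position `k` to position `k + 1`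
(`isSignedStarRep_piPlus_psi`). Along the sweep the signs `-1` move from the first `m` positions to
the last `m` positions, and these are the signs in the definition of the involution.

*The element `x`.* The iterated coproduct of the minor `t` is a sum over sequences of row indices,
along which each letter raises the sum of the indices by at most one (`wordRep_qMinor_eq_zero`).
From the rows of `t` to its columns the sum grows by `mn`, the number of letters, so every letter
must raise it, and the only summand left is the one given by the sweep: `t` acts as the tensor
product of the operators `π_+(t_{12})` (`IsSweep.wordRep_qMinor`). This operator is diagonal with
real nonzero eigenvalues `q^{-∑ k_j}`, hence symmetric; by the first part `t^*` acts by the same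
operator, and `x` by its square (`repT_xElem`).
-/

namespace QGroup

/-! ### Cofactors, the comultiplication and the homomorphisms `psi` -/

theorem map_qCofactor {R S : Type*} [Ring R] [Algebra ℂ R] [Ring S] [Algebra ℂ S] {q : ℂ} {N : ℕ}
    (f : R →ₐ[ℂ] S) (M : Fin N → Fin N → R) (i j : Fin N) :
    f (qCofactor q M i j) = qCofactor q (fun i j => f (M i j)) i j := by
  simp only [qCofactor, map_smul, map_qMinor]

theorem qCofactor_two {R : Type*} [Ring R] [Algebra ℂ R] {q : ℂ} (M : Fin 2 → Fin 2 → R)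
    (i j : Fin 2) : qCofactor q M i j = (-q) ^ ((j : ℤ) - (i : ℤ)) • M i.rev j.rev := by
  have hskip : ∀ i : Fin 2, skip i (0 : Fin 1) = i.rev := by decide
  have h1 : invLength (1 : Equiv.Perm (Fin 1)) = 0 := by decide
  have hm : qMinor q M (skip i : Fin 1 → Fin 2) (skip j) = M i.rev j.rev := by
    rw [qMinor, Fintype.sum_eq_single (1 : Equiv.Perm (Fin 1))
      (fun s hs => absurd (Subsingleton.elim s 1) hs), h1]
    simp [hskip]
  exact congrArg _ hm

namespace CSL
variable {q : QParam} {N : ℕ}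

theorem comul_t (i j : Fin N) :
    comul q N (t i j) = ∑ k, t i k ⊗ₜ[ℂ] t k j := lift_t _ _ _ i j

theorem counit_t (i j : Fin N) : counit q N (t i j) = if i = j then 1 else 0 := lift_t _ _ _ i j

theorem psi_t (k : Fin (N - 1)) (i j : Fin N) :
    psi (q := q) k (t i j) = blockMatrix t k i j := lift_t _ _ _ i j

/-- A homomorphism takes the transposed cofactor matrix to a left inverse of the image of `t`, if
there is one. -/
theorem map_cofactor_eq {B : Type*} [Ring B] [Algebra ℂ B] (f : CSL q N →ₐ[ℂ] B)
    (X : Fin N → Fin N → B) (hX : ∀ i j, ∑ k, X k i * f (t k j) = if i = j then 1 else 0)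
    (i j : Fin N) : f (qCofactor q.toC t i j) = X i j := by
  have hr : ∀ i j, ∑ k, f (t i k) * f (qCofactor q.toC t j k) = if i = j then 1 else 0 := by
    intro i j
    have h := congrArg f (cofactor_right isQMatrix_t q.ne_zero (qDet_t (q := q)) i j)
    rw [map_sum] at h
    simp only [map_mul] at h
    rw [h]
    split_ifs <;> simp
  have h := left_inv_eq_right_inv (U := fun i j => X j i)
    (V := fun i j => f (qCofactor q.toC t j i)) (M := fun i j => f (t i j)) hX hr
  exact (congrFun (congrFun h j) i).symm

theorem comul_cofactor (i j : Fin N) : comul q N (qCofactor q.toC t i j) =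
    ∑ k, qCofactor q.toC t i k ⊗ₜ[ℂ] qCofactor q.toC t k j := by
  refine map_cofactor_eq (comul q N)
    (fun i j => ∑ k, qCofactor q.toC t i k ⊗ₜ[ℂ] qCofactor q.toC t k j) (fun i j => ?_) i j
  have hl := cofactor_left isQMatrix_t q.ne_zero (q.sum_ne_zero N) (qDet_t (q := q) (N := N))
  have e : ∀ k, (∑ a, qCofactor q.toC t k a ⊗ₜ[ℂ] qCofactor q.toC t a i) *
      (∑ b, t k b ⊗ₜ[ℂ] t b j) = ∑ a, ∑ b,
        (qCofactor q.toC (t (q := q)) k a * t k b) ⊗ₜ[ℂ]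
          (qCofactor q.toC (t (q := q)) a i * t b j) := by
    intro k
    simp only [Finset.sum_mul_sum, Algebra.TensorProduct.tmul_mul_tmul]
  simp only [comul_t, e]
  rw [Finset.sum_comm]
  have e2 : ∀ a, ∑ k, ∑ b, (qCofactor q.toC (t (q := q)) k a * t k b) ⊗ₜ[ℂ]
      (qCofactor q.toC (t (q := q)) a i * t b j) =
        (1 : CSL q N) ⊗ₜ[ℂ] (qCofactor q.toC (t (q := q)) a i * t a j) := by
    intro a
    rw [Finset.sum_comm, Finset.sum_eq_single a]
    · rw [← TensorProduct.sum_tmul, hl, if_pos rfl]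
    · intro b _ hb
      rw [← TensorProduct.sum_tmul, hl, if_neg hb.symm, TensorProduct.zero_tmul]
    · simp
  simp only [e2]
  rw [← TensorProduct.tmul_sum, hl]
  split_ifs <;> simp [Algebra.TensorProduct.one_def]

theorem counit_cofactor (i j : Fin N) :
    counit q N (qCofactor q.toC t i j) = if i = j then 1 else 0 := by
  refine map_cofactor_eq (counit q N) (fun i j => if i = j then 1 else 0) (fun i j => ?_) i j
  simp [counit_t, eq_comm]

theorem psi_cofactor (k : Fin (N - 1)) (i j : Fin N) : psi (q := q) k (qCofactor q.toC t i j) =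
    blockMatrix (qCofactor q.toC t) k i j := by
  refine map_cofactor_eq (psi k) (blockMatrix (qCofactor q.toC t) k) (fun i j => ?_) i j
  have hl := cofactor_left isQMatrix_t q.ne_zero (q.sum_ne_zero 2) (qDet_t (q := q) (N := 2))
  have hlh : (lo k : Fin N) ≠ hi k := by simp [lo, hi]
  simp only [psi_t]
  by_cases hi' : i = lo k ∨ i = hi k
  · rw [← Finset.sum_subset (Finset.subset_univ {lo k, hi k}), Finset.sum_pair hlh]
    · by_cases hj : j = lo k ∨ j = hi k
      · have h := hl (if i = lo k then 0 else 1) (if j = lo k then 0 else 1)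
        rw [Fin.sum_univ_two] at h
        simp only [blockMatrix, hi', hj, true_or, or_true, and_self, if_true, hlh.symm, if_false, h]
        rcases hi' with rfl | rfl <;> rcases hj with rfl | rfl <;> simp [hlh, hlh.symm]
      · have h1 : i ≠ j := by rintro rfl; exact hj hi'
        push Not at hj
        simp [blockMatrix, hj, hj.1.symm, hj.2.symm, h1]
    · intro a _ ha
      have h3 : a ≠ lo k ∧ a ≠ hi k := by simpa using ha
      have h4 : a ≠ i := by rintro rfl; exact hi'.elim h3.1 h3.2
      simp [blockMatrix, h3, h4]
  · rw [Finset.sum_eq_single i]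
    · simp [blockMatrix, hi']
    · intro b _ hb
      simp [blockMatrix, hi', hb]
    · simp

end CSL

/-! ### Representations compatible with a family of signs -/

/-- The operators `π (t i j)` have the adjoints `a i * b j` times the operators of the cofactors.
For `a i = sgnRow m n i` and `b j = sgnCol m n j` this says that `π` respects the involution of
`ℂ[G̃]_q` on the generators; the other families of signs correspond to other real forms. -/
def IsSignedStarRep {q : QParam} {N : ℕ} {V : Type*} [NormedAddCommGroup V]
    [InnerProductSpace ℂ V] (a b : Fin N → ℝ) (π : CSL q N →ₐ[ℂ] Module.End ℂ V) : Prop :=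
  ∀ i j v w, inner ℂ (π (CSL.t i j) v) w =
    ((a i * b j : ℝ) : ℂ) * inner ℂ v (π (qCofactor q.toC CSL.t i j) w)

section
variable {q : QParam} {N : ℕ} {V W : Type*} [NormedAddCommGroup V] [InnerProductSpace ℂ V]
  [NormedAddCommGroup W] [InnerProductSpace ℂ W]

theorem tensorRep_t (π : CSL q N →ₐ[ℂ] Module.End ℂ V) (ρ : CSL q N →ₐ[ℂ] Module.End ℂ W)
    (i j : Fin N) : tensorRep π ρ (CSL.t i j) =
      ∑ k, TensorProduct.map (π (CSL.t i k)) (ρ (CSL.t k j)) := by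
  simp only [tensorRep, AlgHom.comp_apply, CSL.comul_t, map_sum]
  rfl

theorem tensorRep_cofactor (π : CSL q N →ₐ[ℂ] Module.End ℂ V)
    (ρ : CSL q N →ₐ[ℂ] Module.End ℂ W) (i j : Fin N) :
    tensorRep π ρ (qCofactor q.toC CSL.t i j) =
      ∑ k, TensorProduct.map (π (qCofactor q.toC CSL.t i k)) (ρ (qCofactor q.toC CSL.t k j)) := by
  simp only [tensorRep, AlgHom.comp_apply, CSL.comul_cofactor, map_sum]
  rfl

/-- Two operators on a tensor product are adjoint up to a factor if they are so on pure tensors. -/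
theorem inner_tensor_ext {c : ℂ} {f g : Module.End ℂ (V ⊗[ℂ] W)}
    (h : ∀ x y x' y', inner ℂ (f (x ⊗ₜ y)) (x' ⊗ₜ[ℂ] y') = c * inner ℂ (x ⊗ₜ[ℂ] y) (g (x' ⊗ₜ y')))
    (v w : V ⊗[ℂ] W) : inner ℂ (f v) w = c * inner ℂ v (g w) := by
  induction v using TensorProduct.induction_on with
  | zero => simp
  | add v v' hv hv' => rw [map_add, inner_add_left, inner_add_left, hv, hv', mul_add]
  | tmul x y =>
    induction w using TensorProduct.induction_on with
    | zero => simp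
    | add w w' hw hw' => rw [map_add, inner_add_right, inner_add_right, hw, hw', mul_add]
    | tmul x' y' => exact h x y x' y'

theorem IsSignedStarRep.tensor {a b c : Fin N → ℝ} (hb : ∀ k, b k * b k = 1)
    {π : CSL q N →ₐ[ℂ] Module.End ℂ V} {ρ : CSL q N →ₐ[ℂ] Module.End ℂ W}
    (hπ : IsSignedStarRep a b π) (hρ : IsSignedStarRep b c ρ) :
    IsSignedStarRep a c (tensorRep π ρ) := by
  intro i j
  refine inner_tensor_ext fun x y x' y' => ?_
  rw [tensorRep_t, tensorRep_cofactor]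
  simp only [LinearMap.sum_apply, TensorProduct.map_tmul, sum_inner, inner_sum,
    TensorProduct.inner_tmul, Finset.mul_sum]
  refine Finset.sum_congr rfl fun k _ => ?_
  rw [hπ, hρ]
  have h : ((b k : ℂ)) * b k = 1 := by exact_mod_cast hb k
  push_cast
  linear_combination (a i * c j * inner ℂ x (π (qCofactor q.toC CSL.t i k) x') *
    inner ℂ y (ρ (qCofactor q.toC CSL.t k j) y')) * h

theorem isSignedStarRep_trivial {a : Fin N → ℝ} (ha : ∀ k, a k * a k = 1) :
    IsSignedStarRep a a (trivialRep q N) := by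
  intro i j v w
  have h1 : trivialRep q N (CSL.t i j) = if i = j then 1 else 0 := by
    rw [trivialRep, AlgHom.comp_apply, CSL.counit_t]; split_ifs <;> simp
  have h2 : trivialRep q N (qCofactor q.toC CSL.t i j) = if i = j then 1 else 0 := by
    rw [trivialRep, AlgHom.comp_apply, CSL.counit_cofactor]; split_ifs <;> simp
  rw [h1, h2]
  by_cases hij : i = j
  · subst hij
    rw [ha]
    simp
  · simp [hij]

theorem Lplus.inner_ext {c : ℂ} {f g : Module.End ℂ (Lplus q)}
    (h : ∀ i j, inner ℂ (f (e q i)) (e q j) = c * inner ℂ (e q i) (g (e q j)))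
    (v w : Lplus q) : inner ℂ (f v) w = c * inner ℂ v (g w) := by
  have hs : ∀ x : Lplus q, x ∈ Submodule.span ℂ (Set.range (e q)) :=
    fun x => (basis q).mem_span x
  refine Submodule.span_induction (p := fun v _ => inner ℂ (f v) w = c * inner ℂ v (g w))
    ?_ (by simp) ?_ ?_ (hs v)
  · rintro _ ⟨i, rfl⟩
    refine Submodule.span_induction
      (p := fun w _ => inner ℂ (f (e q i)) w = c * inner ℂ (e q i) (g w))
      ?_ (by simp) ?_ ?_ (hs w)
    · rintro _ ⟨j, rfl⟩
      exact h i j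
    · intro x y _ _ hx hy
      rw [map_add, inner_add_right, inner_add_right, hx, hy, mul_add]
    · intro z x _ hx
      rw [map_smul, inner_smul_right, inner_smul_right, hx]; ring
  · intro x y _ _ hx hy
    rw [map_add, inner_add_left, inner_add_left, hx, hy, mul_add]
  · intro z x _ hx
    rw [map_smul, inner_smul_left, inner_smul_left, hx]; ring

theorem Lplus.weight_succ (j : ℕ) :
    (weight q (j + 1) : ℂ) = weight q j * ((q.toC ^ (2 * (j + 1)))⁻¹ - 1) := by
  rw [weight, Finset.prod_range_succ, ← weight]
  push_cast
  rfl

/-- In `𝓛_+` the diagonal entries `t_{11}`, `t_{22}` have the adjoints opposite to those of the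
compact real form, and the entries `t_{12}`, `t_{21}` the same ones. -/
theorem Lplus.inner_piGen (i j : Fin 2) (v w : Lplus q) : inner ℂ (piGen q i j v) w =
    (if i = j then -1 else 1 : ℂ) * inner ℂ v (qCofactor q.toC (piGen q) i j w) := by
  have hq := q.ne_zero
  have h12 : ∀ j : ℕ, piGen q 1 1 (e q (j + 1)) =
      (1 - (q.toC ^ (2 * (j + 1)))⁻¹) • e q j := by
    intro j; rw [piGen_11, if_neg (by omega)]; rfl
  have h10 : piGen q 1 1 (e q 0) = 0 := by rw [piGen_11, if_pos rfl]
  have hr : (starRingEnd ℂ) q.toC = q.toC := Complex.conj_ofReal _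
  refine inner_ext (fun k l => ?_) v w
  rw [qCofactor_two, LinearMap.smul_apply]
  fin_cases i <;> fin_cases j
  · change inner ℂ (piGen q 0 0 _) _ = _ * inner ℂ _ (_ • piGen q 1 1 _)
    rw [piGen_00, inner_e]
    cases l with
    | zero => simp [h10]
    | succ l =>
      rw [h12, inner_smul_right, inner_smul_right, inner_e]
      by_cases h : k = l
      · subst h; simp [weight_succ]; ring
      · simp [h]
  · change inner ℂ (piGen q 0 1 _) _ = _ * inner ℂ _ (_ • piGen q 1 0 _)
    rw [piGen_01, piGen_10, inner_smul_left, inner_smul_right, inner_smul_right, inner_e]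
    by_cases h : k = l
    · subst h
      simp only [map_inv₀, map_pow, hr]
      simp
      field_simp
      ring
    · simp [h]
  · change inner ℂ (piGen q 1 0 _) _ = _ * inner ℂ _ (_ • piGen q 0 1 _)
    rw [piGen_01, piGen_10, inner_smul_left, inner_smul_right, inner_smul_right, inner_e]
    by_cases h : k = l
    · subst h
      simp only [map_neg, map_inv₀, map_pow, hr]
      simp
      field_simp
      ring
    · simp [h]
  · change inner ℂ (piGen q 1 1 _) _ = _ * inner ℂ _ (_ • piGen q 0 0 _)
    rw [piGen_00, inner_smul_right, inner_e]
    cases k with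
    | zero => simp [h10]
    | succ k =>
      rw [h12, inner_smul_left, inner_e]
      by_cases h : k = l
      · subst h; simp [weight_succ]; ring
      · simp [h]

theorem Lplus.piPlus_t (i j : Fin 2) : piPlus q (CSL.t i j) = piGen q i j := CSL.lift_t _ _ _ i j

theorem Lplus.piPlus_psi_t (k : Fin (N - 1)) (i j : Fin N) :
    (piPlus q).comp (CSL.psi k) (CSL.t i j) = blockMatrix (piGen q) k i j := by
  rw [AlgHom.comp_apply, CSL.psi_t]
  simp only [blockMatrix]
  split_ifs <;> simp [piPlus_t]

theorem Lplus.piPlus_psi_cofactor (k : Fin (N - 1)) (i j : Fin N) :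
    (piPlus q).comp (CSL.psi k) (qCofactor q.toC CSL.t i j) =
      blockMatrix (qCofactor q.toC (piGen q)) k i j := by
  rw [AlgHom.comp_apply, CSL.psi_cofactor]
  simp only [blockMatrix, apply_ite (piPlus q), map_qCofactor, piPlus_t, map_one, map_zero]

/-- `π_+ ∘ ψ_{(k,k+1)}` moves a sign `-1` from position `k` to position `k + 1`. -/
theorem isSignedStarRep_piPlus_psi (k : Fin (N - 1)) {a b : Fin N → ℝ} (h0 : a (lo k) = -1)
    (h1 : a (hi k) = 1) (h2 : b (lo k) = 1) (h3 : b (hi k) = -1)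
    (h4 : ∀ i, i ≠ lo k → i ≠ hi k → a i * b i = 1) :
    IsSignedStarRep a b ((Lplus.piPlus q).comp (CSL.psi k)) := by
  have hlh : (lo k : Fin N) ≠ hi k := by simp [lo, hi]
  intro i j v w
  rw [Lplus.piPlus_psi_t, Lplus.piPlus_psi_cofactor]
  by_cases h : (i = lo k ∨ i = hi k) ∧ (j = lo k ∨ j = hi k)
  · simp only [blockMatrix, h, and_self, if_true]
    rw [Lplus.inner_piGen]
    rcases h with ⟨rfl | rfl, rfl | rfl⟩ <;> simp [hlh.symm, h0, h1, h2, h3]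
  · simp only [blockMatrix, h, if_false]
    by_cases hij : i = j
    · subst hij
      rw [h4 i (by tauto) (by tauto)]
      simp
    · simp [hij]

end

/-! ### Minors under the comultiplication -/

section
variable {R : Type*} [Ring R] [Algebra ℂ R] {q : ℂ} {N : ℕ}

/-- The coproduct formula for minors, in a form that sums over all sequences `f` of indices, not only
over the increasing ones: the minors of `M'` with rows `f` need not be sorted, and only products of
entries of `M` occur. -/
theorem qMinor_mul {M M' : Fin N → Fin N → R}  (hc : ∀ i j k l, Commute (M i j) (M' k l)) {k : ℕ} (r c : Fin k → Fin N) (hcm : StrictMono c) :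
    qMinor q (fun i j => ∑ l, M i l * M' l j) r c =
      ∑ f : Fin k → Fin N, (List.ofFn fun p => M (r p) (f p)).prod * qMinor q M' f c := by
  have h1 := prod_expand (c := fun i j => scal R N (M i j))
    (x := fun i => ∑ j, scal R N (M' i j) * fock R q N j) (by
      intro i j l
      refine Commute.sum_left _ _ _ fun k _ => Commute.mul_left ?_ (fock_scal _ _)
      exact ((hc i j l k).map (scal R N)).symm) r
  have h2 : (fun i => ∑ j, scal R N (M i j) * ∑ k, scal R N (M' j k) * fock R q N k) =
      fun i => ∑ k, scal R N (∑ j, M i j * M' j k) * fock R q N k := by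
    funext i
    simp only [Finset.mul_sum, map_sum, map_mul, Finset.sum_mul, mul_assoc]
    exact Finset.sum_comm
  have h3 : (List.ofFn fun p => ∑ j, scal R N (M (r p) j) *
      ∑ k, scal R N (M' j k) * fock R q N k) =
      List.ofFn fun p => ∑ k, scal R N (∑ j, M (r p) j * M' j k) * fock R q N k :=
    congrArg List.ofFn (funext fun p => congrFun h2 (r p))
  rw [h3] at h1
  rw [← coeff_minor _ r c hcm, h1, Matrix.sum_apply]
  refine Finset.sum_congr rfl fun f _ => ?_
  have e : (List.ofFn fun p => scal R N (M (r p) (f p))) =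
      (List.ofFn fun p => M (r p) (f p)).map (scal R N) := by rw [List.map_ofFn]; rfl
  rw [e, ← map_list_prod, scal_mul, coeff_minor _ f c hcm]

theorem qMinor_eq_zero_of_not_injective {M : Fin N → Fin N → R} (hM : IsQMatrix q M) (hq : q ≠ 0)
    {k : ℕ} (r c : Fin k → Fin N) (hcm : StrictMono c) (hr : ¬ Function.Injective r) :
    qMinor q M r c = 0 := by
  have hx : IsQExt q (fun i => ∑ j, scal R N (M i j) * fock R q N j) :=
    fock_ext.comb (hM.map (scal R N)) hq (fun i j l => fock_scal l _)
  rw [← coeff_minor M r c hcm, hx.not_inj r hr, Matrix.zero_apply]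

theorem qMinor_one_self {k : ℕ} {c : Fin k → Fin N} (hc : Function.Injective c) :
    qMinor q (fun i j : Fin N => if i = j then (1 : R) else 0) c c = 1 := by
  rw [qMinor, Fintype.sum_eq_single 1]
  · have h1 : invLength (1 : Equiv.Perm (Fin k)) = 0 := by
      rw [invLength, Finset.card_eq_zero, Finset.filter_eq_empty_iff]
      rintro p - ⟨h1, h2⟩
      exact lt_asymm h1 h2
    simp [h1]
  · intro s hs
    obtain ⟨p, hp⟩ : ∃ p, s p ≠ p := by
      by_contra! hall
      exact hs (Equiv.ext hall)
    rw [List.prod_eq_zero, smul_zero]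
    exact List.mem_ofFn.2 ⟨p, if_neg fun h => hp (hc h).symm⟩

theorem qMinor_one_eq_zero {k : ℕ} {r c : Fin k → Fin N}
    (h : ∑ p, (r p : ℕ) ≠ ∑ p, (c p : ℕ)) :
    qMinor q (fun i j : Fin N => if i = j then (1 : R) else 0) r c = 0 := by
  refine Finset.sum_eq_zero fun s _ => ?_
  obtain ⟨p, hp⟩ : ∃ p, r p ≠ c (s p) := by
    by_contra! hall
    refine h ?_
    simp only [hall]
    exact Equiv.sum_comp s fun p => (c p : ℕ)
  rw [List.prod_eq_zero, smul_zero]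
  exact List.mem_ofFn.2 ⟨p, if_neg hp⟩

theorem prod_ofFn_eq_single {A : Type*} [Monoid A] : ∀ {k : ℕ} (y : Fin k → A) (p : Fin k),
    (∀ p', p' ≠ p → y p' = 1) → (List.ofFn y).prod = y p
  | 0, _, p, _ => p.elim0
  | k + 1, y, p, h => by
    rw [List.ofFn_succ, List.prod_cons]
    cases p using Fin.cases with
    | zero =>
      rw [List.prod_eq_one, mul_one]
      intro a ha
      obtain ⟨p', rfl⟩ := List.mem_ofFn.1 ha
      exact h _ (Fin.succ_ne_zero p')
    | succ p =>
      rw [h 0 (Fin.succ_ne_zero p).symm, one_mul]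
      exact prod_ofFn_eq_single (fun p => y p.succ) p
        fun p' hp' => h _ fun e => hp' (Fin.succ_injective _ e)

end

theorem CSL.comul_qMinor {q : QParam} {N k : ℕ} (r c : Fin k → Fin N) (hc : StrictMono c) :
    comul q N (qMinor q.toC t r c) = ∑ f : Fin k → Fin N,
      (List.ofFn fun p => t (r p) (f p)).prod ⊗ₜ[ℂ] qMinor q.toC t f c := by
  have h := qMinor_mul (M := fun i j => Algebra.TensorProduct.includeLeft (R := ℂ) (S := ℂ)
    (A := CSL q N) (B := CSL q N) (t i j)) (M' := fun i j =>
      Algebra.TensorProduct.includeRight (R := ℂ) (A := CSL q N) (B := CSL q N) (t i j))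
      (q := q.toC) (fun i j k l => by simp [Commute, SemiconjBy]) r c hc
  simp only [← map_qMinor] at h
  rw [map_qMinor]
  simp only [comul_t]
  have e : (fun i j : Fin N => ∑ l, (t i l : CSL q N) ⊗ₜ[ℂ] (t l j : CSL q N)) = fun i j =>
      ∑ l, Algebra.TensorProduct.includeLeft (R := ℂ) (S := ℂ) (A := CSL q N) (B := CSL q N) (t i l) *
        Algebra.TensorProduct.includeRight (R := ℂ) (A := CSL q N) (B := CSL q N) (t l j) := by
    simp
  rw [e, h]
  refine Finset.sum_congr rfl fun f _ => ?_
  have e2 : (List.ofFn fun p => Algebra.TensorProduct.includeLeft (R := ℂ) (S := ℂ) (A := CSL q N)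
      (B := CSL q N) (t (r p) (f p))) = (List.ofFn fun p => t (r p) (f p)).map
        (Algebra.TensorProduct.includeLeft (R := ℂ) (S := ℂ) (A := CSL q N) (B := CSL q N)) := by
    rw [List.map_ofFn]; rfl
  rw [e2, ← map_list_prod]
  simp

theorem tensorRep_qMinor {q : QParam} {N k : ℕ} {V W : Type*} [AddCommGroup V] [Module ℂ V]
    [AddCommGroup W] [Module ℂ W] (π : CSL q N →ₐ[ℂ] Module.End ℂ V)
    (ρ : CSL q N →ₐ[ℂ] Module.End ℂ W) (r c : Fin k → Fin N) (hc : StrictMono c) :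
    tensorRep π ρ (qMinor q.toC CSL.t r c) = ∑ f : Fin k → Fin N,
      TensorProduct.map (List.ofFn fun p => π (CSL.t (r p) (f p))).prod
        (ρ (qMinor q.toC CSL.t f c)) := by
  rw [tensorRep, AlgHom.comp_apply, AlgHom.comp_apply, CSL.comul_qMinor r c hc, map_sum, map_sum]
  refine Finset.sum_congr rfl fun f _ => ?_
  have e : (List.ofFn fun p => π (CSL.t (r p) (f p))) =
      (List.ofFn fun p => CSL.t (r p) (f p)).map π := by rw [List.map_ofFn]; rfl
  rw [e, ← map_list_prod]
  rfl

/-! ### Minors in tensor powers of `π_+` -/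

section
variable {q : QParam} {N : ℕ}

/-- The only nonzero entry of a block matrix above the diagonal is the one in row `k` and column
`k + 1`; a product of entries vanishes if one of them is another entry above the diagonal. -/
theorem block_prod_eq_zero {R : Type*} [Ring R] [Algebra ℂ R] (M : Fin 2 → Fin 2 → R)
    (k : Fin (N - 1)) {l : ℕ} (r f : Fin l → Fin N) (p : Fin l)
    (hp : (r p : ℕ) + (if r p = lo k then 1 else 0) < f p) :
    (List.ofFn fun p => blockMatrix M k (r p) (f p)).prod = 0 := by
  refine List.prod_eq_zero (List.mem_ofFn.2 ⟨p, ?_⟩)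
  rw [blockMatrix, if_neg, if_neg]
  · rintro h
    rw [h] at hp
    omega
  · rintro ⟨h1 | h1, h2 | h2⟩ <;> simp only [h1, h2] at hp <;> simp [lo, hi] at hp

theorem sum_step_le {l : ℕ} (k : Fin (N - 1)) {r : Fin l → Fin N} (hr : Function.Injective r) :
    ∑ p, ((r p : ℕ) + if r p = lo k then 1 else 0) ≤ ∑ p, (r p : ℕ) + 1 := by
  rw [Finset.sum_add_distrib, ← Finset.card_filter]
  refine Nat.add_le_add_left (Finset.card_le_one.2 ?_) _
  intro a ha b hb
  simp only [Finset.mem_filter, Finset.mem_univ, true_and] at ha hb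
  exact hr (ha.trans hb.symm)

/-- Each letter raises the sum of the row indices by at most one, so a word is too short for
minors whose column indices have a large sum. -/
theorem wordRep_qMinor_eq_zero {l : ℕ} {c : Fin l → Fin N} (hc : StrictMono c) :
    ∀ (R : ℕ) (σ : Fin R → Fin (N - 1)) (r : Fin l → Fin N),
      ∑ p, (r p : ℕ) + R < ∑ p, (c p : ℕ) → wordRep q N R σ (qMinor q.toC CSL.t r c) = 0
  | 0, σ, r, h => by
    have h1 : CSL.counit q N (qMinor q.toC CSL.t r c) = 0 := by
      rw [map_qMinor]
      simp only [CSL.counit_t]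
      exact qMinor_one_eq_zero (by omega)
    change trivialRep q N _ = 0
    rw [trivialRep, AlgHom.comp_apply, h1, map_zero]
  | R + 1, σ, r, h => by
    by_cases hr : Function.Injective r
    swap
    · rw [qMinor_eq_zero_of_not_injective CSL.isQMatrix_t q.ne_zero r c hc hr, map_zero]
    refine (tensorRep_qMinor ((Lplus.piPlus q).comp (CSL.psi (σ 0)))
      (wordRep q N R (Fin.tail σ)) r c hc).trans (Finset.sum_eq_zero fun f _ => ?_)
    simp only [Lplus.piPlus_psi_t]
    by_cases hf : ∃ p, (r p : ℕ) + (if r p = lo (σ 0) then 1 else 0) < f p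
    · obtain ⟨p, hp⟩ := hf
      rw [block_prod_eq_zero _ _ _ _ p hp, TensorProduct.map_zero_left]
    · push Not at hf
      have h1 := Finset.sum_le_sum fun p (_ : p ∈ Finset.univ) => hf p
      have h2 := sum_step_le (σ 0) hr
      rw [wordRep_qMinor_eq_zero hc R (Fin.tail σ) f (by omega), TensorProduct.map_zero_right]

end

/-! ### Words that move a set of positions upwards -/

/-- The permutations `P 0, P 1, …` arise from one another by the letters of the word `σ`, and each
letter `(k, k+1)` moves the item at `k`, one of the items `0, …, m-1`, past the item at `k + 1`,
one of the other items. Here `P s x` is the position of the item `x` after `s` letters. -/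
structure IsSweep {m n R : ℕ} (σ : Fin R → Fin (m + n - 1))
    (P : ℕ → Equiv.Perm (Fin (m + n))) : Prop where
  step : ∀ s : Fin R, P (s + 1) = adjSwap (σ s) * P s
  low : ∀ s : Fin R, ((P s).symm (lo (σ s)) : ℕ) < m
  high : ∀ s : Fin R, m ≤ ((P s).symm (hi (σ s)) : ℕ)

namespace IsSweep
variable {m n R : ℕ} {P : ℕ → Equiv.Perm (Fin (m + n))}

theorem tail {σ : Fin (R + 1) → Fin (m + n - 1)} (h : IsSweep σ P) :
    IsSweep (Fin.tail σ) (fun s => P (s + 1)) where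
  step s := h.step s.succ
  low s := h.low s.succ
  high s := h.high s.succ

theorem prod_eq : ∀ {R : ℕ} {σ : Fin R → Fin (m + n - 1)} {P : ℕ → Equiv.Perm (Fin (m + n))},
    IsSweep σ P → (List.ofFn fun p => adjSwap (σ p)).prod = P 0 * (P R)⁻¹
  | 0, σ, P, _ => by simp
  | R + 1, σ, P, h => by
    have h1 : P 1 = adjSwap (σ 0) * P 0 := h.step 0
    rw [List.ofFn_succ, List.prod_cons]
    refine (congrArg _ (prod_eq h.tail)).trans ?_
    rw [zero_add, h1, mul_assoc, ← mul_assoc (adjSwap (σ 0)), adjSwap, Equiv.swap_mul_self, one_mul]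

/-- The positions of the first `m` items. -/
def rows (P : ℕ → Equiv.Perm (Fin (m + n))) (s : ℕ) (p : Fin m) : Fin (m + n) :=
  P s (Fin.castAdd n p)

theorem rows_injective (P : ℕ → Equiv.Perm (Fin (m + n))) (s : ℕ) :
    Function.Injective (rows P s) :=
  (P s).injective.comp (Fin.castAdd_injective m n)

theorem exists_rows_eq_lo {σ : Fin R → Fin (m + n - 1)} (h : IsSweep σ P) (s : Fin R) :
    ∃ p, rows P s p = lo (σ s) :=
  ⟨⟨_, h.low s⟩, by simp [rows, Fin.castAdd, Fin.castLE]⟩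

theorem rows_ne_hi {σ : Fin R → Fin (m + n - 1)} (h : IsSweep σ P) (s : Fin R) (p : Fin m) :
    rows P s p ≠ hi (σ s) := by
  intro e
  have h1 := h.high s
  rw [← e, rows, Equiv.symm_apply_apply, Fin.val_castAdd] at h1
  omega

theorem rows_succ {σ : Fin R → Fin (m + n - 1)} (h : IsSweep σ P) (s : Fin R) (p : Fin m) :
    rows P (s + 1) p = if rows P s p = lo (σ s) then hi (σ s) else rows P s p := by
  rw [rows, h.step, Equiv.Perm.mul_apply, adjSwap, Equiv.swap_apply_def]
  change (if rows P s p = _ then _ else if rows P s p = _ then _ else rows P s p) = _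
  rw [if_neg (h.rows_ne_hi s p)]

theorem val_rows_succ {σ : Fin R → Fin (m + n - 1)} (h : IsSweep σ P) (s : Fin R) (p : Fin m) :
    (rows P (s + 1) p : ℕ) = rows P s p + if rows P s p = lo (σ s) then 1 else 0 := by
  rw [h.rows_succ]
  split_ifs with h1
  · rw [h1]; rfl
  · rfl

theorem sum_rows_succ {σ : Fin R → Fin (m + n - 1)} (h : IsSweep σ P) (s : Fin R) :
    ∑ p, (rows P (s + 1) p : ℕ) = ∑ p, (rows P s p : ℕ) + 1 := by
  obtain ⟨p, hp⟩ := h.exists_rows_eq_lo s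
  simp only [h.val_rows_succ, Finset.sum_add_distrib]
  rw [Fintype.sum_eq_single (f := fun p => if rows P s p = lo (σ s) then 1 else 0) p, if_pos hp]
  intro p' hp'
  rw [if_neg]
  intro e
  exact hp' (rows_injective P s (e.trans hp.symm))

theorem sum_rows : ∀ {R : ℕ} {σ : Fin R → Fin (m + n - 1)} {P : ℕ → Equiv.Perm (Fin (m + n))},
    IsSweep σ P → ∑ p, (rows P R p : ℕ) = ∑ p, (rows P 0 p : ℕ) + R
  | 0, _, _, _ => rfl
  | R + 1, σ, P, h => by
    have h1 := sum_rows h.tail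
    have h2 := h.sum_rows_succ 0
    change ∑ p, (rows P (R + 1) p : ℕ) = ∑ p, (rows P 1 p : ℕ) + R at h1
    change ∑ p, (rows P 1 p : ℕ) = ∑ p, (rows P 0 p : ℕ) + 1 at h2
    omega

end IsSweep

/-- The tensor product of `r` copies of the operator `π_+(t_{12})`. -/
noncomputable def diagPow (q : QParam) : (r : ℕ) → Module.End ℂ (LplusPow q r)
  | 0 => 1
  | r + 1 => TensorProduct.map (Lplus.piGen q 0 1) (diagPow q r)

/-- All summands of the iterated coproduct of the minor vanish but the one in which every letter
raises a row index. -/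
theorem IsSweep.wordRep_qMinor {q : QParam} {m n : ℕ} : ∀ {R : ℕ} {σ : Fin R → Fin (m + n - 1)}
    {P : ℕ → Equiv.Perm (Fin (m + n))}, IsSweep σ P → StrictMono (rows P R) →
    wordRep q (m + n) R σ (qMinor q.toC CSL.t (rows P 0) (rows P R)) = diagPow q R
  | 0, σ, P, _, hc => by
    have h1 : CSL.counit q (m + n) (qMinor q.toC CSL.t (rows P 0) (rows P 0)) = 1 := by
      rw [map_qMinor]
      simp only [CSL.counit_t]
      exact qMinor_one_self hc.injective
    change trivialRep q (m + n) _ = 1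
    rw [trivialRep, AlgHom.comp_apply, h1, map_one]
  | R + 1, σ, P, h, hc => by
    have ih := wordRep_qMinor (q := q) h.tail hc
    have hsum := h.sum_rows
    refine (tensorRep_qMinor ((Lplus.piPlus q).comp (CSL.psi (σ 0)))
      (wordRep q (m + n) R (Fin.tail σ)) _ _ hc).trans ?_
    simp only [Lplus.piPlus_psi_t]
    have hv := h.val_rows_succ 0
    change ∀ p, (rows P 1 p : ℕ) = rows P 0 p + if rows P 0 p = lo (σ 0) then 1 else 0 at hv
    rw [Fintype.sum_eq_single (rows P 1)]
    · have e : (List.ofFn fun p => blockMatrix (Lplus.piGen q) (σ 0) (rows P 0 p)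
          (rows P 1 p)).prod = Lplus.piGen q 0 1 := by
        have hlh : (lo (σ 0) : Fin (m + n)) ≠ hi (σ 0) := by simp [lo, hi]
        have hs := h.rows_succ 0
        change ∀ p, rows P 1 p = if rows P 0 p = lo (σ 0) then hi (σ 0) else rows P 0 p at hs
        obtain ⟨p, hp⟩ := h.exists_rows_eq_lo 0
        change rows P 0 p = lo (σ 0) at hp
        rw [prod_ofFn_eq_single _ p]
        · rw [hs, hp, if_pos rfl]
          simp [blockMatrix, hlh.symm]
        · intro p' hp'
          have h1 : rows P 0 p' ≠ lo (σ 0) :=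
            fun e => hp' (rows_injective P 0 (e.trans hp.symm))
          have h2 : rows P 0 p' ≠ hi (σ 0) := h.rows_ne_hi 0 p'
          rw [hs, if_neg h1]
          simp [blockMatrix, h1, h2]
      rw [e]
      exact congrArg _ ih
    · intro f hf
      by_cases hf' : ∃ p, (rows P 0 p : ℕ) + (if rows P 0 p = lo (σ 0) then 1 else 0) < f p
      · obtain ⟨p, hp⟩ := hf'
        rw [block_prod_eq_zero _ _ _ _ p hp, TensorProduct.map_zero_left]
      · push Not at hf'
        -- The indices `f p` do not exceed those of the sweep and differ from them, so their sum is
        -- too small for the remaining word.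
        simp only [← hv] at hf'
        obtain ⟨p, hp⟩ : ∃ p, f p ≠ rows P 1 p := by
          by_contra! hall
          exact hf (funext hall)
        have h1 : ∑ p, (f p : ℕ) < ∑ p, (rows P 1 p : ℕ) :=
          Finset.sum_lt_sum (fun p _ => hf' p)
            ⟨p, Finset.mem_univ p, lt_of_le_of_ne (hf' p) fun e => hp (Fin.ext e)⟩
        have h2 : ∑ p, (rows P 1 p : ℕ) = ∑ p, (rows P 0 p : ℕ) + 1 := h.sum_rows_succ 0
        rw [wordRep_qMinor_eq_zero hc R (Fin.tail σ) f (by omega), TensorProduct.map_zero_right]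

/-- The sign `-1` at the positions of the first `m` items, and `1` elsewhere. -/
noncomputable def sweepSign {m n : ℕ} (P : ℕ → Equiv.Perm (Fin (m + n))) (s : ℕ)
    (i : Fin (m + n)) : ℝ :=
  if ((P s).symm i : ℕ) < m then -1 else 1

theorem sweepSign_mul_self {m n : ℕ} (P : ℕ → Equiv.Perm (Fin (m + n))) (s : ℕ)
    (i : Fin (m + n)) : sweepSign P s i * sweepSign P s i = 1 := by
  unfold sweepSign; split_ifs <;> norm_num

theorem IsSweep.isSignedStarRep {q : QParam} {m n : ℕ} :
    ∀ {R : ℕ} {σ : Fin R → Fin (m + n - 1)} {P : ℕ → Equiv.Perm (Fin (m + n))}, IsSweep σ P →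
    IsSignedStarRep (sweepSign P 0) (sweepSign P R) (wordRep q (m + n) R σ)
  | 0, _, P, _ => isSignedStarRep_trivial (sweepSign_mul_self P 0)
  | R + 1, σ, P, h => by
    have ih := isSignedStarRep (q := q) h.tail
    change IsSignedStarRep (sweepSign P 1) (sweepSign P (R + 1)) _ at ih
    refine IsSignedStarRep.tensor (sweepSign_mul_self P 1) (isSignedStarRep_piPlus_psi (σ 0)
      (if_pos (h.low 0)) (if_neg (h.high 0).not_gt) ?_ ?_ ?_) ih
    all_goals
      have h1 : P 1 = adjSwap (σ 0) * P 0 := h.step 0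
      have h2 : ∀ i, (P 1).symm i = (P 0).symm (adjSwap (σ 0) i) := by
        intro i
        rw [Equiv.symm_apply_eq, h1]
        simp [adjSwap]
    · rw [sweepSign, h2, adjSwap, Equiv.swap_apply_left]
      exact if_neg (h.high 0).not_gt
    · rw [sweepSign, h2, adjSwap, Equiv.swap_apply_right]
      exact if_pos (h.low 0)
    · intro i h3 h4
      have h5 : sweepSign P 1 i = sweepSign P 0 i := by
        rw [sweepSign, h2, adjSwap, Equiv.swap_apply_of_ne_of_ne h3 h4, sweepSign]
      rw [h5, sweepSign_mul_self]

/-! ### The word of `u` -/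

/-- The position of the item `x` after `d` complete words `s_i` and `e` letters of the next one:
the items `m-1, …, m-d` have moved up by `n`, the item `m-d-1` by `e`, and every item `x ≥ m` has
moved down by one for each of them that has passed it. -/
def sweepPos (m n d e x : ℕ) : ℕ :=
  if x < m then x + (if m ≤ x + d then n else if x + d + 1 = m then e else 0)
  else x - d - (if x < m + e then 1 else 0)

/-- The inverses of the partial products of the word `uWord m n`. -/
def sweepPerm (m n : ℕ) : ℕ → Equiv.Perm (Fin (m + n))
  | 0 => 1
  | s + 1 => (if h : s < m * n then adjSwap (uWord m n ⟨s, h⟩) else 1) * sweepPerm m n s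

theorem sweepPos_succ {m n d e x y : ℕ} (hd : d < m) (he : e < n)
    (hy : y = sweepPos m n d e x) : sweepPos m n d (e + 1) x =
      if y = m - 1 - d + e then m - 1 - d + e + 1
      else if y = m - 1 - d + e + 1 then m - 1 - d + e else y := by
  subst hy
  unfold sweepPos
  split_ifs <;> omega

theorem sweepPos_carry {m n d x : ℕ} (hd : d < m) (hx : x < m + n) :
    sweepPos m n (d + 1) 0 x = sweepPos m n d n x := by
  unfold sweepPos
  split_ifs <;> omega

theorem sweepPerm_val {m n : ℕ} (s : ℕ) (hs : s ≤ m * n) (x : Fin (m + n)) :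
    (sweepPerm m n s x : ℕ) = sweepPos m n (s / n) (s % n) x := by
  induction s with
  | zero =>
    rcases Nat.lt_or_ge x m with h | h
    · simp [sweepPerm, sweepPos, h, h.not_ge]
    · simp [sweepPerm, sweepPos, h.not_gt]
  | succ s ih =>
    have ih := ih (by omega)
    have hn : 0 < n := Nat.pos_of_ne_zero (by rintro rfl; omega)
    have he : s % n < n := Nat.mod_lt s hn
    have hd : s / n < m := (Nat.div_lt_iff_lt_mul hn).2 (by omega)
    have hstep : sweepPos m n ((s + 1) / n) ((s + 1) % n) x =
        sweepPos m n (s / n) (s % n + 1) x := by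
      rcases Nat.lt_or_ge (s % n + 1) n with h | h
      · have h1 : (s + 1) / n = s / n ∧ (s + 1) % n = s % n + 1 := by
          rw [Nat.div_mod_unique hn]
          exact ⟨by have := Nat.mod_add_div s n; omega, h⟩
        rw [h1.1, h1.2]
      · have h1 : (s + 1) / n = s / n + 1 ∧ (s + 1) % n = 0 := by
          rw [Nat.div_mod_unique hn]
          exact ⟨by have := Nat.mod_add_div s n; rw [mul_add]; omega, hn⟩
        rw [h1.1, h1.2, sweepPos_carry hd x.2, show s % n + 1 = n by omega]
    rw [hstep, sweepPos_succ hd he ih, sweepPerm, dif_pos (show s < m * n by omega),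
      Equiv.Perm.mul_apply, adjSwap, Equiv.swap_apply_def]
    simp only [Fin.ext_iff, lo, hi, uWord]
    split_ifs <;> rfl

theorem isSweep_uWord (m n : ℕ) : IsSweep (uWord m n) (sweepPerm m n) := by
  have key : ∀ s : Fin (m * n), (s : ℕ) / n < m ∧ (s : ℕ) % n < n := by
    intro s
    have hn : 0 < n := Nat.pos_of_ne_zero (by rintro rfl; exact absurd s.2 (by simp))
    exact ⟨(Nat.div_lt_iff_lt_mul hn).2 s.2, Nat.mod_lt _ hn⟩
  constructor
  · intro s
    rw [sweepPerm, dif_pos s.2]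
  · intro s
    obtain ⟨hd, he⟩ := key s
    have hx : m - 1 - s / n < m + n := by
      generalize (s : ℕ) / n = d at *
      generalize (s : ℕ) % n = e at *
      omega
    have h : (sweepPerm m n s).symm (lo (uWord m n s)) = ⟨m - 1 - s / n, hx⟩ := by
      rw [Equiv.symm_apply_eq, Fin.ext_iff, sweepPerm_val _ s.2.le]
      simp only [lo, uWord, sweepPos]
      generalize (s : ℕ) / n = d at *
      generalize (s : ℕ) % n = e at *
      split_ifs <;> omega
    rw [h]
    exact (Nat.sub_le _ _).trans_lt (Nat.sub_lt (Nat.zero_lt_of_lt hd) one_pos)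
  · intro s
    obtain ⟨hd, he⟩ := key s
    have hx : m + s % n < m + n := by
      generalize (s : ℕ) / n = d at *
      generalize (s : ℕ) % n = e at *
      omega
    have h : (sweepPerm m n s).symm (hi (uWord m n s)) = ⟨m + s % n, hx⟩ := by
      rw [Equiv.symm_apply_eq, Fin.ext_iff, sweepPerm_val _ s.2.le]
      simp only [hi, uWord, sweepPos]
      generalize (s : ℕ) / n = d at *
      generalize (s : ℕ) % n = e at *
      split_ifs <;> omega
    rw [h]
    exact Nat.le_add_right _ _

theorem sweepPerm_last {m n : ℕ} (hn : 1 ≤ n) : sweepPerm m n (m * n) = (uPerm m n)⁻¹ := by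
  ext x
  have := x.2
  have h : (((uPerm m n)⁻¹ x : Fin (m + n)) : ℕ) = if x.1 < m then n + x else x - m := by
    change (((uPerm m n).symm x : Fin (m + n)) : ℕ) = _
    rw [uPerm, Equiv.coe_fn_symm_mk]
    split_ifs <;> rfl
  rw [sweepPerm_val _ le_rfl, Nat.mul_div_cancel _ hn, Nat.mul_mod_left, h, sweepPos]
  split_ifs <;> omega

theorem prod_uWord {m n : ℕ} (hn : 1 ≤ n) :
    (List.ofFn fun p => adjSwap (uWord m n p)).prod = uPerm m n := by
  rw [(isSweep_uWord m n).prod_eq, sweepPerm_last hn, inv_inv]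
  exact one_mul _

/-- The inversions of `u` are the pairs of one of the first `n` positions and one of the others. -/
theorem invLength_uPerm (m n : ℕ) : invLength (uPerm m n) = m * n := by
  have hu : ∀ j : Fin (m + n), (uPerm m n j : ℕ) = if j.1 < n then m + j else j - n := by
    intro j
    rw [uPerm, Equiv.coe_fn_mk]
    split_ifs <;> rfl
  have hcard : m * n = (Finset.univ : Finset (Fin n × Fin m)).card := by
    simp [mul_comm]
  rw [hcard, invLength]
  symm
  refine Finset.card_bij (fun p _ => (⟨p.1, by omega⟩, ⟨n + p.2, by omega⟩)) ?_ ?_ ?_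
  · rintro ⟨i, j⟩ -
    simp only [Finset.mem_filter, Finset.mem_univ, true_and, Fin.lt_def, hu]
    rw [if_pos i.2, if_neg (by omega)]
    omega
  · rintro ⟨i, j⟩ - ⟨i', j'⟩ - h
    simp only [Prod.mk.injEq, Fin.mk.injEq] at h
    exact Prod.ext (Fin.ext h.1) (Fin.ext (by dsimp only; omega))
  · rintro ⟨i, j⟩ h
    simp only [Finset.mem_filter, Finset.mem_univ, true_and, Fin.lt_def, hu] at h
    have h1 : i.1 < n ∧ n ≤ j.1 := by
      obtain ⟨h1, h2⟩ := h
      split_ifs at h2 <;> omega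
    exact ⟨(⟨i, h1.1⟩, ⟨j - n, by omega⟩), Finset.mem_univ _,
      Prod.ext rfl (Fin.ext (by dsimp only; omega))⟩

/-! ### The representation of `ℂ[G̃]_q` -/

theorem repT_tMinor (q : QParam) {m n : ℕ} (hn : 1 ≤ n) :
    repT q m n (tMinor q m n) = diagPow q (m * n) := by
  have hlast : IsSweep.rows (sweepPerm m n) (m * n) = fun p : Fin m => ⟨n + p, by omega⟩ := by
    funext p
    rw [IsSweep.rows, sweepPerm_last hn]
    exact dif_pos p.2
  have h := (isSweep_uWord m n).wordRep_qMinor (q := q) (by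
    rw [hlast]
    intro a b hab
    exact Nat.add_lt_add_left hab n)
  rw [hlast] at h
  exact h

theorem isStarRep_repT (q : QParam) {m n : ℕ} (hn : 1 ≤ n) : IsStarRep (repT q m n) := by
  have h := (isSweep_uWord m n).isSignedStarRep (q := q)
  have h0 : ∀ i, ((sweepSign (sweepPerm m n) 0 i : ℝ) : ℂ) = CG.sgnRow m n i := by
    intro i
    simp only [sweepSign, CG.sgnRow, sweepPerm]
    change ((if i.1 < m then (-1 : ℝ) else 1 : ℝ) : ℂ) = _
    split_ifs <;> simp
  have h1 : ∀ j, ((sweepSign (sweepPerm m n) (m * n) j : ℝ) : ℂ) = CG.sgnCol m n j := by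
    intro j
    have hj : (((sweepPerm m n (m * n)).symm j : Fin (m + n)) : ℕ) =
        if j.1 < n then m + j else j - n := by
      rw [sweepPerm_last hn]
      change (uPerm m n j : ℕ) = _
      rw [uPerm, Equiv.coe_fn_mk]
      split_ifs <;> rfl
    simp only [sweepSign, CG.sgnCol, hj]
    split_ifs <;> first | omega | simp
  intro f
  refine CG.induction (p := fun f => ∀ v w : LplusPow q (m * n),
    inner ℂ (repT q m n f v) w = inner ℂ v (repT q m n (star f) w)) ?_ ?_ ?_ ?_ f
  · intro c v w
    rw [CG.star_algebraMap', AlgHom.commutes, AlgHom.commutes, Module.algebraMap_end_apply,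
      Module.algebraMap_end_apply, inner_smul_left, inner_smul_right]
    rfl
  · intro i j v w
    rw [CG.star_t, CG.starGen_eq, map_smul, LinearMap.smul_apply, inner_smul_right, ← h0, ← h1,
      ← Complex.ofReal_mul]
    exact h i j v w
  · intro a b ha hb v w
    rw [star_mul, map_mul, map_mul, Module.End.mul_apply, Module.End.mul_apply, ha, hb]
  · intro a b ha hb v w
    rw [star_add, map_add, map_add, LinearMap.add_apply, LinearMap.add_apply, inner_add_left,
      inner_add_right, ha, hb]

theorem inner_diagPow (q : QParam) : ∀ (r : ℕ) (v w : LplusPow q r),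
    inner ℂ (diagPow q r v) w = inner ℂ v (diagPow q r w)
  | 0, _, _ => rfl
  | r + 1, v, w => by
    have hr : (starRingEnd ℂ) q.toC = q.toC := Complex.conj_ofReal _
    have h1 : ∀ x y : Lplus q, inner ℂ (Lplus.piGen q 0 1 x) y =
        inner ℂ x (Lplus.piGen q 0 1 y) := by
      intro x y
      rw [← one_mul (inner ℂ x _)]
      refine Lplus.inner_ext (fun i j => ?_) x y
      rw [Lplus.piGen_01, Lplus.piGen_01, inner_smul_left, inner_smul_right, Lplus.inner_e]
      by_cases hij : i = j
      · subst hij; simp [hr]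
      · simp [hij]
    have h := inner_tensor_ext (c := 1) (f := TensorProduct.map (Lplus.piGen q 0 1) (diagPow q r))
      (g := TensorProduct.map (Lplus.piGen q 0 1) (diagPow q r)) (fun x y x' y' => by
        simp only [TensorProduct.map_tmul, TensorProduct.inner_tmul, h1, inner_diagPow q r, one_mul])
      v w
    rw [one_mul] at h
    exact h

theorem repT_xElem (q : QParam) {m n : ℕ} (hn : 1 ≤ n) :
    repT q m n (xElem q m n) = diagPow q (m * n) * diagPow q (m * n) := by
  have h : repT q m n (star (tMinor q m n)) = diagPow q (m * n) := by
    refine LinearMap.ext fun w => ext_inner_left ℂ fun v => ?_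
    rw [← isStarRep_repT q hn, repT_tMinor q hn, inner_diagPow]
  rw [xElem, map_mul, h, repT_tMinor q hn]

theorem diagPow_eTensor (q : QParam) : ∀ (r : ℕ) (k : Fin r → ℕ),
    diagPow q r (eTensor q r k) = (q.toC ^ (-∑ j, (k j : ℤ))) • eTensor q r k
  | 0, _ => by simp [diagPow]
  | r + 1, k => by
    change Lplus.piGen q 0 1 (Lplus.e q (k 0)) ⊗ₜ[ℂ] diagPow q r (eTensor q r (Fin.tail k)) =
      _ • Lplus.e q (k 0) ⊗ₜ[ℂ] eTensor q r (Fin.tail k)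
    have hz : q.toC ^ (-∑ j, (k j : ℤ)) =
        (q.toC ^ k 0)⁻¹ * q.toC ^ (-∑ j, (Fin.tail k j : ℤ)) := by
      rw [Fin.sum_univ_succ, neg_add, zpow_add₀ q.ne_zero, zpow_neg, zpow_natCast]
      rfl
    rw [Lplus.piGen_01, diagPow_eTensor q r, TensorProduct.smul_tmul_smul, hz]
    rfl

theorem isUnit_diagPow (q : QParam) : ∀ r : ℕ, IsUnit (diagPow q r)
  | 0 => isUnit_one
  | r + 1 => by
    obtain ⟨b, hb, hb'⟩ := isUnit_iff_exists.1 (isUnit_diagPow q r)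
    let a : Module.End ℂ (Lplus q) := (Lplus.basis q).constr ℂ fun j => q.toC ^ j • Lplus.e q j
    have ha : ∀ j, a (Lplus.e q j) = q.toC ^ j • Lplus.e q j :=
      fun j => Module.Basis.constr_basis _ _ _ _
    have h1 : Lplus.piGen q 0 1 * a = 1 := Lplus.end_ext fun j => by
      simp [ha, Lplus.piGen_01, smul_smul, q.ne_zero]
    have h2 : a * Lplus.piGen q 0 1 = 1 := Lplus.end_ext fun j => by
      simp [ha, Lplus.piGen_01, smul_smul, q.ne_zero]
    refine isUnit_iff_exists.2 ⟨TensorProduct.map a b, ?_, ?_⟩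
    · exact (TensorProduct.map_mul _ _ _ _).symm.trans (by rw [h1, hb]; exact TensorProduct.map_one)
    · exact (TensorProduct.map_mul _ _ _ _).symm.trans (by rw [h2, hb']; exact TensorProduct.map_one)

end QGroup

theorem mainTheorem9 (q : QGroup.QParam) (m n : ℕ) (hm : 1 ≤ m) (hn : 1 ≤ n) :
    ((List.ofFn fun p => QGroup.adjSwap (QGroup.uWord m n p)).prod = QGroup.uPerm m n ∧
      QGroup.invLength (QGroup.uPerm m n) = m * n) ∧
    QGroup.IsStarRep (QGroup.repT q m n) ∧
    (∀ k : Fin (m * n) → ℕ,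
      QGroup.repT q m n (QGroup.xElem q m n) (QGroup.eTensor q (m * n) k) =
        (q.toC ^ (-2 * ∑ j, (k j : ℤ))) • QGroup.eTensor q (m * n) k) ∧
    IsUnit (QGroup.repT q m n (QGroup.xElem q m n)) := by
  refine ⟨⟨QGroup.prod_uWord hn, QGroup.invLength_uPerm m n⟩, QGroup.isStarRep_repT q hn,
    fun k => ?_, ?_⟩
  · rw [QGroup.repT_xElem q hn, Module.End.mul_apply, QGroup.diagPow_eTensor, map_smul,
      QGroup.diagPow_eTensor, smul_smul, ← zpow_add₀ q.ne_zero]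
    congr 2
    ring
  · rw [QGroup.repT_xElem q hn]
    exact (QGroup.isUnit_diagPow q _).mul (QGroup.isUnit_diagPow q _)
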